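/- Let $\theta,a,\lambda>0$ and let $N_{\theta,a}(t)$, $t\ge 0$, be a homogeneous Poisson process with rate $\theta$ and jumps of size $a$ (that is, $N_{\theta,a}=aN$ for a homogeneous Poisson counting process $N$ of rate $\theta$), on a probability space $(\Omega,\mathcal F,P)$. Consider the stochastic differential equation $$dX(t)=-\lambda X(t)\,dt+dN_{\theta,a}(\lambda t),\qquad t\ge 0,$$ that is, almost surely $X(t)=X(0)-\lambda\int_0^t X(s)\,ds+N_{\theta,a}(\lambda t)$ for all $t\ge0$. A probability law on $\mathbb R$ is called the generalised Dickman distribution $GD(\theta,a)$ if a random variable $D$ with this law satisfies $D\overset{d}{=}U^{1/\theta}(a+D)$, where $U$ is uniform on $(0,1]$ and independent of $D$. A strictly stationary solution exists: there is a $GD(\theta,a)$ law $\mu$ such that, on the enlarged probability space $(\Omega\times\mathbb R,P\otimes\mu)$, the equation driven by $N_{\theta,a}$ has a strictly stationary solution $X$ whose initial value $X(0)$ is the second coordinate (hence independent of $N_{\theta,a}$). Every strictly stationary solution $X$ (called a Dickman OU process) has marginal law $GD(\theta,a)$, that is $X(t)\sim GD(\theta,a)$ for every $t\ge0$, it is square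 integrable, and $$\mathrm{Cov}(X(t),X(t+\tau))=e^{-\lambda\tau}\,\mathrm{Var}\,X(t)=a^2\,\frac{\theta}{2}\,e^{-\lambda\tau},\qquad t,\tau\ge 0.$$ -/

import Mathlib

open MeasureTheory ProbabilityTheory Set
open scoped NNReal

/-- `N` is a homogeneous Poisson process with rate `θ` and jumps of size `a`, i.e. `a` times a
standard (unit jump) Poisson counting process of rate `θ`: it starts at `0`, has independent
increments, the increment over `(s, t]` is `a` times a Poisson variable of mean `θ (t - s)`, and
almost every path is nondecreasing and right-continuous (left limits then exist). -/
structure IsPoissonProcess {Ω : Type*} [MeasurableSpace Ω] (θ : ℝ≥0) (a : ℝ)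
    (N : ℝ≥0 → Ω → ℝ) (P : Measure Ω) : Prop where
  zero : ∀ᵐ ω ∂P, N 0 ω = 0
  indep : HasIndepIncrements N P
  law : ∀ s t : ℝ≥0, s ≤ t →
    HasLaw (fun ω ↦ N t ω - N s ω) ((poissonMeasure (θ * (t - s))).map fun k : ℕ ↦ a * (k : ℝ)) P
  paths : ∀ᵐ ω ∂P, Monotone (fun t ↦ N t ω) ∧
    ∀ t : ℝ≥0, ContinuousWithinAt (fun s ↦ N s ω) (Ici t) t

/-- `X` is (strictly) stationary: its finite-dimensional laws are invariant under time shifts.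
(`IdentDistrib` includes the a.e. measurability of the vectors.) -/
def IsStrictlyStationary {Ω : Type*} [MeasurableSpace Ω] (X : ℝ≥0 → Ω → ℝ)
    (P : Measure Ω) : Prop :=
  ∀ (h : ℝ≥0) (I : Finset ℝ≥0),
    IdentDistrib (fun ω (i : I) ↦ X (i + h) ω) (fun ω (i : I) ↦ X i ω) P P

/-- `X` is a solution of `dX(t) = -λ X(t) dt + dZ(λ t)`, `t ≥ 0`, where `lam` is `λ`: almost surely
the path of `X` is integrable on every `[0, t]` and
`X(t) = X(0) - λ ∫₀ᵗ X(s) ds + (Z(λ t) - Z(0))` for all `t ≥ 0` simultaneously. The noise is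
additive, so this integrated form needs no stochastic integral; it makes `X` càdlàg whenever `Z`
is, and makes `X` a functional of `X(0)` and `Z`. -/
structure IsOUSolution {Ω : Type*} [MeasurableSpace Ω] (lam : ℝ≥0)
    (Z X : ℝ≥0 → Ω → ℝ) (P : Measure Ω) : Prop where
  aemeasurable : ∀ t, AEMeasurable (X t) P
  eqn : ∀ᵐ ω ∂P, ∀ t : ℝ≥0,
    IntervalIntegrable (fun s : ℝ ↦ X s.toNNReal ω) volume 0 t ∧
    X t ω = X 0 ω - lam * (∫ s in (0 : ℝ)..t, X s.toNNReal ω) + (Z (lam * t) ω - Z 0 ω)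

/-- The generalised Dickman distribution `GD(θ, a)`: `μ` is the law of a random variable `D` with
`D` equal in distribution to `U ^ (1 / θ) * (a + D)`, where `U` is uniform on `(0, 1]` and
independent of `D`. -/
def IsGenDickman (θ : ℝ≥0) (a : ℝ) (μ : Measure ℝ) : Prop :=
  IsProbabilityMeasure μ ∧
    ((volume.restrict (Ioc (0 : ℝ) 1)).prod μ).map
      (fun p : ℝ × ℝ ↦ p.1 ^ (1 / (θ : ℝ)) * (a + p.2)) = μ

/-!
Write `Z(t) = N(λ t)`, a Poisson process of rate `θ λ`. Variation of constants turns the equation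
into `X(t) = e^(-λ t) X(0) + Y(t)` with the stochastic convolution `Y(t) = ∫₀ᵗ e^(-λ (t - s)) dZ(s)`,
which is defined path by path through integration by parts (`eq_of_integral_equation`,
`integral_equation_of_eq`). Everything else is computed with characteristic functions.

Since `Y` is a pathwise limit of Riemann-Stieltjes sums over independent Poisson increments, a
linear combination `∑ c j * Y(t j)` has characteristic function
`exp(θ λ ∫_{s > 0} (e^(i a g(s)) - 1) ds)`, where `g` is the kernel `ouKernel`
(`IsPoissonProcess.integral_cexp_sum_ouNoise`). The same integral over the whole line,
`stationaryExponent`, is invariant under time shifts. For one time it gives the function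
`φ(u) = exp(θ ∫_{s > 0} (e^(i a u e^(-s)) - 1) ds)`, called `dickmanCharFun`.

A law with characteristic function `φ` is `GD(θ, a)`: the fixed point equation amounts to
integrating the derivative of `e^(-θ s) φ(u e^(-s))` over `(0, ∞)`. Such a law is square integrable
because `1 - Re φ(u) = O(u²)`, and then the fixed point equation yields its first two moments.

*Existence.* `φ` is the limit of the characteristic functions of `Y(t)`, so it belongs to a law `μ`
by Lévy's theorem. A `μ`-distributed initial value independent of the noise contributes exactly the
part of the whole-line integral over `s < 0`, so all joint characteristic functions of `X` are
shift invariant.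

*Arbitrary stationary solutions.* Here `X(0)` may depend on the noise. By stationarity the joint law
at the times `t j` is that at the times `t j + n`, and as `n → ∞` the term `e^(-λ (t j + n)) X(0)`
disappears; so the joint characteristic functions are again given by the whole-line integral
(`IsStrictlyStationary.integral_cexp_sum`). This identifies the marginals, and, because the kernels
of `X(t)` and of the innovation `X(t + τ) - e^(-λ τ) X(t)` have disjoint supports, it shows that
these two are independent, whence `Cov(X(t), X(t + τ)) = e^(-λ τ) Var X(t)`.
-/

open Filter Topology

/-! ### Pathwise variation of constants -/

/-- The Stieltjes integral `∫₀ᵗ e ^ (l s) dM(s)` along a path `M` with `M 0 = 0`, encoded through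
integration by parts so that it makes sense pathwise without a Stieltjes measure. -/
noncomputable def expIntegral (l : ℝ) (M : ℝ → ℝ) (t : ℝ) : ℝ :=
  Real.exp (l * t) * M t - l * ∫ s in (0 : ℝ)..t, Real.exp (l * s) * M s

section Deterministic

variable {l t : ℝ} {M x : ℝ → ℝ}

lemma integral_mul_exp (l u v : ℝ) :
    ∫ s in u..v, l * Real.exp (l * s) = Real.exp (l * v) - Real.exp (l * u) := by
  refine intervalIntegral.integral_eq_sub_of_hasDerivAt (f := fun s ↦ Real.exp (l * s))
    (fun s _ ↦ ?_) (Continuous.intervalIntegrable (by fun_prop) _ _)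
  exact (((hasDerivAt_id s).const_mul l).exp).congr_deriv (by simp; ring)

lemma Monotone.intervalIntegrable_exp_mul (hM : Monotone M) (l a b : ℝ) :
    IntervalIntegrable (fun s ↦ Real.exp (l * s) * M s) volume a b :=
  hM.intervalIntegrable.continuousOn_mul (by fun_prop)

lemma hasDerivWithinAt_integral_exp_mul (hM : Monotone M)
    (hr : ∀ s, ContinuousWithinAt M (Ici s) s) (l t : ℝ) :
    HasDerivWithinAt (fun u ↦ ∫ s in (0 : ℝ)..u, Real.exp (l * s) * M s)
      (Real.exp (l * t) * M t) (Ioi t) t := by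
  have hc : ContinuousWithinAt (fun s ↦ Real.exp (l * s) * M s) (Ioi t) t :=
    ContinuousWithinAt.mul (by fun_prop) ((hr t).mono Ioi_subset_Ici_self)
  have hmeas : Measurable (fun s ↦ Real.exp (l * s) * M s) := by
    have := hM.measurable
    fun_prop
  exact (intervalIntegral.integral_hasDerivWithinAt_right (s := Ici t) (t := Ioi t)
    (hM.intervalIntegrable_exp_mul l 0 t)
    hmeas.stronglyMeasurable.stronglyMeasurableAtFilter hc).mono Ioi_subset_Ici_self

lemma continuous_integral_exp_mul (hM : Monotone M) (l : ℝ) :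
    Continuous (fun u ↦ ∫ s in (0 : ℝ)..u, Real.exp (l * s) * M s) :=
  intervalIntegral.continuous_primitive (fun a b ↦ hM.intervalIntegrable_exp_mul l a b) 0

/-- Variation of constants: a solution of the integrated Ornstein-Uhlenbeck equation is determined
by its initial value and the driving path. -/
lemma eq_of_integral_equation (hM : Monotone M)
    (hr : ∀ s, ContinuousWithinAt M (Ici s) s)
    (hx : ∀ t, 0 ≤ t → IntervalIntegrable x volume 0 t ∧
      x t = x 0 - l * (∫ s in (0 : ℝ)..t, x s) + M t) (ht : 0 ≤ t) :
    x t = Real.exp (-l * t) * (x 0 + expIntegral l M t) := by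
  have hcont (T : ℝ) (hT : 0 ≤ T) :
      ContinuousOn (fun u ↦ ∫ s in (0 : ℝ)..u, x s) (Icc 0 T) := by
    have := intervalIntegral.continuousOn_primitive_interval' (hx T hT).1 left_mem_uIcc
    rwa [uIcc_of_le hT] at this
  have hderiv (s : ℝ) (hs : s ∈ Ioo 0 t) :
      HasDerivWithinAt (fun u ↦ ∫ s in (0 : ℝ)..u, x s) (x s) (Ioi s) s := by
    have hxc : ContinuousWithinAt x (Ioi s) s := by
      have h1 : ContinuousWithinAt (fun u ↦ ∫ s in (0 : ℝ)..u, x s) (Ioi s) s :=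
        ((hcont t ht).continuousAt (Icc_mem_nhds hs.1 hs.2)).continuousWithinAt
      have h2 : ContinuousWithinAt
          (fun u ↦ x 0 - l * (∫ s in (0 : ℝ)..u, x s) + M u) (Ioi s) s :=
        (continuousWithinAt_const.sub (h1.const_mul l)).add ((hr s).mono Ioi_subset_Ici_self)
      refine h2.congr (fun u hu ↦ (hx u (hs.1.le.trans (le_of_lt hu))).2) (hx s hs.1.le).2
    refine (intervalIntegral.integral_hasDerivWithinAt_right (s := Ici s) (t := Ioi s)
      (hx s hs.1.le).1 ?_ hxc).mono Ioi_subset_Ici_self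
    refine ⟨Ioc s t, Ioc_mem_nhdsGT hs.2, ?_⟩
    have := (hx t ht).1.1.aestronglyMeasurable
    exact this.mono_measure (Measure.restrict_mono (Ioc_subset_Ioc_left hs.1.le) le_rfl)
  have hM' := hM.intervalIntegrable_exp_mul l 0 t
  have hE : IntervalIntegrable (fun s ↦ Real.exp (l * s) * x 0) volume 0 t :=
    Continuous.intervalIntegrable (by fun_prop) _ _
  -- `x` has jumps, so only the right derivative of `e ^ (l u) ∫₀ᵘ x` exists everywhere
  have key : ∫ s in (0 : ℝ)..t, (Real.exp (l * s) * x 0 + Real.exp (l * s) * M s) =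
      Real.exp (l * t) * (∫ s in (0 : ℝ)..t, x s)
        - Real.exp (l * 0) * (∫ s in (0 : ℝ)..0, x s) := by
    refine intervalIntegral.integral_eq_sub_of_hasDeriv_right_of_le
      (f := fun u ↦ Real.exp (l * u) * ∫ s in (0 : ℝ)..u, x s) ht ?_ ?_ (hE.add hM')
    · exact ContinuousOn.mul (by fun_prop) (hcont t ht)
    · intro s hs
      have h1 : HasDerivWithinAt (fun u ↦ Real.exp (l * u)) (Real.exp (l * s) * (l * 1)) (Ioi s) s :=
        ((hasDerivAt_id s).const_mul l).exp.hasDerivWithinAt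
      refine (h1.mul (hderiv s hs)).congr_deriv ?_
      conv_lhs => rw [(hx s hs.1.le).2]
      ring
  rw [intervalIntegral.integral_add hE hM', intervalIntegral.integral_mul_const] at key
  have hexp := integral_mul_exp l 0 t
  rw [intervalIntegral.integral_const_mul] at hexp
  have hinv : Real.exp (-l * t) * Real.exp (l * t) = 1 := by
    rw [← Real.exp_add]; simp
  simp only [intervalIntegral.integral_same, mul_zero, sub_zero, Real.exp_zero] at key hexp
  rw [(hx t ht).2, expIntegral]
  linear_combination (l * Real.exp (-l * t)) * key - (x 0 * Real.exp (-l * t)) * hexp -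
    (x 0 - l * (∫ s in (0 : ℝ)..t, x s) + M t) * hinv

/-- The variation of constants formula defines a solution of the integrated Ornstein-Uhlenbeck
equation. -/
lemma integral_equation_of_eq (hl : l ≠ 0) (hM : Monotone M)
    (hr : ∀ s, ContinuousWithinAt M (Ici s) s) (c : ℝ) (ht : 0 ≤ t) :
    IntervalIntegrable (fun s ↦ Real.exp (-l * s) * (c + expIntegral l M s)) volume 0 t ∧
    Real.exp (-l * t) * (c + expIntegral l M t) =
      c - l * (∫ s in (0 : ℝ)..t, Real.exp (-l * s) * (c + expIntegral l M s)) + M t := by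
  have hK := continuous_integral_exp_mul hM l
  have hi : IntervalIntegrable (fun s ↦ Real.exp (-l * s) * (c + expIntegral l M s))
      volume 0 t := by
    refine IntervalIntegrable.continuousOn_mul (g := fun s ↦ Real.exp (-l * s)) ?_ (by fun_prop)
    exact (intervalIntegrable_const).add ((hM.intervalIntegrable_exp_mul l 0 t).sub
      (Continuous.intervalIntegrable (by fun_prop) _ _))
  refine ⟨hi, ?_⟩
  -- the candidate for `∫₀ᵘ x`
  set J : ℝ → ℝ := fun u ↦ Real.exp (-l * u) *
    (c * (Real.exp (l * u) - 1) / l + ∫ s in (0 : ℝ)..u, Real.exp (l * s) * M s) with hJ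
  have hexp (s : ℝ) : Real.exp (-l * s) * Real.exp (l * s) = 1 := by
    rw [← Real.exp_add]; simp
  have key := intervalIntegral.integral_eq_sub_of_hasDeriv_right_of_le (f := J)
    (f' := fun s ↦ Real.exp (-l * s) * (c + expIntegral l M s)) ht
    (Continuous.continuousOn (by fun_prop)) (fun s hs ↦ ?_) hi
  · rw [key]
    have := hexp t
    simp only [hJ, expIntegral, intervalIntegral.integral_same]
    field_simp
    simp only [neg_mul] at this
    simp
    linear_combination (c + M t) * this
  · have h1 : HasDerivWithinAt (fun u ↦ Real.exp (-l * u)) (Real.exp (-l * s) * (-l * 1)) (Ioi s) s :=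
      ((hasDerivAt_id s).const_mul (-l)).exp.hasDerivWithinAt
    have h2 : HasDerivWithinAt (fun u ↦ c * (Real.exp (l * u) - 1) / l)
        (c * (Real.exp (l * s) * (l * 1)) / l) (Ioi s) s :=
      ((((hasDerivAt_id s).const_mul l).exp.sub_const 1).const_mul c |>.div_const l).hasDerivWithinAt
    refine (h1.mul (h2.add (hasDerivWithinAt_integral_exp_mul hM hr l s))).congr_deriv ?_
    have := hexp s
    simp only [expIntegral, Pi.add_apply]
    field_simp
    linear_combination (0:ℝ) * this

/-- Replacing the integral over one cell by its left Riemann sum term costs at most the product of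
the increments of integrand and integrator. -/
lemma abs_exp_mul_sub_sub_expIntegral_le (hl : 0 ≤ l) (hM : Monotone M) {u v : ℝ} (huv : u ≤ v) :
    |Real.exp (l * u) * (M v - M u) - (expIntegral l M v - expIntegral l M u)| ≤
      (Real.exp (l * v) - Real.exp (l * u)) * (M v - M u) := by
  have hint := hM.intervalIntegrable_exp_mul l u v
  have hE := integral_mul_exp l u v
  have hadd : (∫ s in (0 : ℝ)..v, Real.exp (l * s) * M s)
      = (∫ s in (0 : ℝ)..u, Real.exp (l * s) * M s) + ∫ s in u..v, Real.exp (l * s) * M s :=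
    (intervalIntegral.integral_add_adjacent_intervals
      (hM.intervalIntegrable_exp_mul l 0 u) hint).symm
  have hlow : (∫ s in u..v, l * Real.exp (l * s) * M u) ≤
      ∫ s in u..v, l * (Real.exp (l * s) * M s) := by
    refine intervalIntegral.integral_mono_on huv (Continuous.intervalIntegrable (by fun_prop) _ _)
      (hint.const_mul l) fun s hs ↦ ?_
    rw [← mul_assoc]
    exact mul_le_mul_of_nonneg_left (hM hs.1) (by positivity)
  have hup : (∫ s in u..v, l * (Real.exp (l * s) * M s)) ≤
      ∫ s in u..v, l * Real.exp (l * s) * M v := by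
    refine intervalIntegral.integral_mono_on huv (hint.const_mul l)
      (Continuous.intervalIntegrable (by fun_prop) _ _) fun s hs ↦ ?_
    rw [← mul_assoc]
    exact mul_le_mul_of_nonneg_left (hM hs.2) (by positivity)
  rw [intervalIntegral.integral_mul_const, hE, intervalIntegral.integral_const_mul] at hlow hup
  simp only [expIntegral, hadd]
  rw [abs_le]
  constructor <;> nlinarith

/-- The left Riemann-Stieltjes sums of `e ^ (l s)` along a grid of mesh `1 / n` that covers
`[0, t]` converge to the pathwise integral. The grid may overshoot `t` by less than `1 / n`;
right continuity of the path takes care of this. -/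
lemma tendsto_sum_expIntegral (hl : 0 ≤ l) (hM : Monotone M)
    (hr : ∀ s, ContinuousWithinAt M (Ici s) s) (h0 : M 0 = 0) (ht : 0 ≤ t) :
    Tendsto (fun n : ℕ ↦ ∑ k ∈ Finset.range ⌈t * n⌉₊,
        Real.exp (l * (k / n : ℝ)) * (M ((k + 1) / n) - M (k / n)))
      atTop (𝓝 (expIntegral l M t)) := by
  -- the right end of the grid
  set T : ℕ → ℝ := fun n ↦ ⌈t * n⌉₊ / n with hT
  have hTle : ∀ᶠ n : ℕ in atTop, t ≤ T n ∧ T n ≤ t + 1 / n := by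
    filter_upwards [eventually_gt_atTop 0] with n hn
    have hn' : (0 : ℝ) < n := by exact_mod_cast hn
    constructor
    · rw [hT, le_div_iff₀ hn']; exact Nat.le_ceil _
    · rw [hT, div_le_iff₀ hn', add_mul, one_div_mul_cancel hn'.ne']
      exact (Nat.ceil_lt_add_one (by positivity)).le
  have hTt : Tendsto T atTop (𝓝[≥] t) := by
    refine tendsto_nhdsWithin_iff.2 ⟨?_, hTle.mono fun n h ↦ h.1⟩
    refine tendsto_of_tendsto_of_tendsto_of_le_of_le' tendsto_const_nhds ?_
      (hTle.mono fun n h ↦ h.1) (hTle.mono fun n h ↦ h.2)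
    simpa using tendsto_const_nhds.add (tendsto_const_nhds.div_atTop
      (tendsto_natCast_atTop_atTop (R := ℝ)) (a := (1 : ℝ)))
  have hcont : ContinuousWithinAt (expIntegral l M) (Ici t) t := by
    have := continuous_integral_exp_mul hM l
    exact (ContinuousWithinAt.mul (by fun_prop) (hr t)).sub (by fun_prop)
  have hlim : Tendsto (fun n ↦ expIntegral l M (T n)) atTop (𝓝 (expIntegral l M t)) :=
    hcont.tendsto.comp hTt
  have hE0 : expIntegral l M 0 = 0 := by simp [expIntegral, h0]
  -- error of the Riemann sum up to the right end of the grid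
  have herr : ∀ᶠ n : ℕ in atTop, ‖(∑ k ∈ Finset.range ⌈t * n⌉₊,
      Real.exp (l * (k / n : ℝ)) * (M ((k + 1) / n) - M (k / n))) - expIntegral l M (T n)‖ ≤
        Real.exp (l * (t + 1)) * (Real.exp (l / n) - 1) * M (t + 1) := by
    filter_upwards [hTle, eventually_gt_atTop 0] with n hTn hn
    have hn' : (0 : ℝ) < n := by exact_mod_cast hn
    have h1n : (1 : ℝ) / n ≤ 1 := by
      rw [div_le_one hn']; exact_mod_cast hn
    have hMT : M (T n) ≤ M (t + 1) := hM (by linarith)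
    have e1 : expIntegral l M (T n) = ∑ k ∈ Finset.range ⌈t * n⌉₊,
        (expIntegral l M ((k + 1) / n) - expIntegral l M (k / n)) := by
      have := Finset.sum_range_sub (fun k : ℕ ↦ expIntegral l M (k / n)) ⌈t * n⌉₊
      simp only [Nat.cast_add, Nat.cast_one, Nat.cast_zero, zero_div, hE0, sub_zero] at this
      rw [this]
    have e2 : M (T n) = ∑ k ∈ Finset.range ⌈t * n⌉₊, (M ((k + 1) / n) - M (k / n)) := by
      have := Finset.sum_range_sub (fun k : ℕ ↦ M (k / n)) ⌈t * n⌉₊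
      simp only [Nat.cast_add, Nat.cast_one, Nat.cast_zero, zero_div, h0, sub_zero] at this
      rw [this]
    have hexp1 : 0 ≤ Real.exp (l / n) - 1 := by
      have : 0 ≤ l / n := by positivity
      linarith [Real.add_one_le_exp (l / n)]
    rw [e1, ← Finset.sum_sub_distrib]
    refine (norm_sum_le _ _).trans ?_
    refine le_trans ?_ (mul_le_mul_of_nonneg_left hMT (by positivity))
    rw [e2, Finset.mul_sum]
    refine Finset.sum_le_sum fun k hk ↦ ?_
    have hkn : (k / n : ℝ) ≤ (k + 1) / n := by gcongr; linarith
    refine (abs_exp_mul_sub_sub_expIntegral_le hl hM hkn).trans ?_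
    refine mul_le_mul_of_nonneg_right ?_ (sub_nonneg.2 (hM hkn))
    have hk' : (k / n : ℝ) ≤ t + 1 := by
      have : (k : ℝ) / n ≤ T n := by
        simp only [hT]; gcongr; exact (Finset.mem_range.1 hk).le
      linarith
    have : Real.exp (l * ((k + 1) / n)) = Real.exp (l * (k / n)) * Real.exp (l / n) := by
      rw [← Real.exp_add]; congr 1; ring
    rw [this]
    have h3 : Real.exp (l * (k / n)) ≤ Real.exp (l * (t + 1)) :=
      Real.exp_le_exp.2 (mul_le_mul_of_nonneg_left hk' hl)
    nlinarith
  have hsmall : Tendsto (fun n : ℕ ↦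
      Real.exp (l * (t + 1)) * (Real.exp (l / n) - 1) * M (t + 1)) atTop (𝓝 0) := by
    have h1 : Tendsto (fun n : ℕ ↦ l / (n : ℝ)) atTop (𝓝 0) :=
      tendsto_const_nhds.div_atTop tendsto_natCast_atTop_atTop
    have h2 := (Real.continuous_exp.tendsto 0).comp h1
    simpa using ((h2.sub_const 1).const_mul (Real.exp (l * (t + 1)))).mul_const (M (t + 1))
  have := (squeeze_zero_norm' herr hsmall).add hlim
  simpa using this

end Deterministic

/-! ### Riemann sums and the kernel of the Ornstein-Uhlenbeck noise -/

/-- The exponent `e ^ (i x) - 1` of the characteristic function of a unit rate Poisson law. -/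
noncomputable def jumpSymbol (x : ℝ) : ℂ := Complex.exp (Complex.I * x) - 1

@[fun_prop]
lemma continuous_jumpSymbol : Continuous jumpSymbol := by
  unfold jumpSymbol; fun_prop

@[simp]
lemma jumpSymbol_zero : jumpSymbol 0 = 0 := by simp [jumpSymbol]

lemma norm_jumpSymbol_le_abs (x : ℝ) : ‖jumpSymbol x‖ ≤ |x| :=
  Real.norm_exp_I_mul_ofReal_sub_one_le

lemma norm_jumpSymbol_le_two (x : ℝ) : ‖jumpSymbol x‖ ≤ 2 := by
  refine (norm_sub_le _ _).trans ?_
  rw [Complex.norm_exp_I_mul_ofReal]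
  norm_num

/-- Left Riemann sums of a bounded, almost everywhere continuous function. -/
lemma tendsto_sum_div_integral {G : ℝ → ℂ} (hG : Measurable G) {C : ℝ} (hC : ∀ s, ‖G s‖ ≤ C)
    (hc : ∀ᵐ s, ContinuousAt G s) (T : ℕ) :
    Tendsto (fun n : ℕ ↦ ∑ k ∈ Finset.range (n * T), (1 / n : ℝ) • G (k / n))
      atTop (𝓝 (∫ s in (0 : ℝ)..T, G s)) := by
  have hstep (n : ℕ) : Measurable (fun s : ℝ ↦ G ((⌊s * n⌋₊ : ℝ) / n)) := by fun_prop
  have hint (n : ℕ) (u v : ℝ) :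
      IntervalIntegrable (fun s : ℝ ↦ G ((⌊s * n⌋₊ : ℝ) / n)) volume u v :=
    (intervalIntegrable_const (c := C)).mono_fun' (hstep n).aestronglyMeasurable
      (ae_of_all _ fun s ↦ hC _)
  have heq : ∀ᶠ n : ℕ in atTop, ∫ s in (0 : ℝ)..T, G ((⌊s * n⌋₊ : ℝ) / n) =
      ∑ k ∈ Finset.range (n * T), (1 / n : ℝ) • G (k / n) := by
    filter_upwards [eventually_gt_atTop 0] with n hn
    have hn' : (0 : ℝ) < n := by exact_mod_cast hn
    have := intervalIntegral.sum_integral_adjacent_intervals (μ := volume)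
      (f := fun s : ℝ ↦ G ((⌊s * n⌋₊ : ℝ) / n)) (a := fun k : ℕ ↦ (k / n : ℝ)) (n := n * T)
      fun k _ ↦ hint n _ _
    simp only [Nat.cast_zero, zero_div, Nat.cast_mul, mul_div_cancel_left₀ _ hn'.ne'] at this
    rw [← this]
    refine Finset.sum_congr rfl fun k _ ↦ ?_
    have hk : (k / n : ℝ) ≤ ((k + 1 : ℕ) : ℝ) / n := by gcongr; simp
    rw [intervalIntegral.integral_of_le hk, ← integral_Ico_eq_integral_Ioc,
      setIntegral_congr_fun (g := fun _ ↦ G (k / n)) measurableSet_Ico fun s hs ↦ ?_]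
    · simp only [integral_const, MeasurableSet.univ, measureReal_restrict_apply, univ_inter,
        Real.volume_real_Ico_of_le hk]
      congr 1
      push_cast; ring
    · have h1 : (k : ℝ) ≤ s * n := (div_le_iff₀ hn').1 hs.1
      have h2 : s * n < (k : ℝ) + 1 := by
        have := (lt_div_iff₀ hn').1 hs.2
        push_cast at this; exact this
      have : ⌊s * n⌋₊ = k := by
        rw [Nat.floor_eq_iff (le_trans (by positivity) h1)]; exact ⟨h1, h2⟩
      simp only [this]
  refine Tendsto.congr' heq ?_
  refine intervalIntegral.tendsto_integral_filter_of_dominated_convergence (fun _ ↦ C)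
    (Eventually.of_forall fun n ↦ (hstep n).aestronglyMeasurable)
    (Eventually.of_forall fun n ↦ ae_of_all _ fun s _ ↦ hC _) intervalIntegrable_const ?_
  filter_upwards [hc] with s hs hsT
  rw [uIoc_of_le (Nat.cast_nonneg T)] at hsT
  exact hs.tendsto.comp ((tendsto_nat_floor_mul_div_atTop hsT.1.le).comp
    tendsto_natCast_atTop_atTop)

section Kernel

variable {ι : Type*} [Fintype ι]

/-- The linear combination with coefficients `c j` of the kernels `e ^ (-l (t j - s)) 1_{s < t j}`,
so that `∑ j, c j * ∫₀^(t j) e ^ (-l (t j - s)) dZ(s)` is the integral of `ouKernel l c t`. -/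
noncomputable def ouKernel (l : ℝ) (c t : ι → ℝ) (s : ℝ) : ℝ :=
  ∑ j, c j * (Iio (t j)).indicator (fun s ↦ Real.exp (-l * (t j - s))) s

variable {l : ℝ} {c t : ι → ℝ}

@[fun_prop]
lemma measurable_ouKernel (l : ℝ) (c t : ι → ℝ) : Measurable (ouKernel l c t) := by
  unfold ouKernel
  refine Finset.measurable_fun_sum _ fun j _ ↦ Measurable.const_mul ?_ _
  exact Measurable.indicator (by fun_prop) measurableSet_Iio

lemma ae_continuousAt_ouKernel (l : ℝ) (c t : ι → ℝ) : ∀ᵐ s, ContinuousAt (ouKernel l c t) s := by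
  have : ∀ᵐ s : ℝ, ∀ j, s ≠ t j := ae_all_iff.2 fun j ↦ Measure.ae_ne volume (t j)
  filter_upwards [this] with s hs
  unfold ouKernel
  refine tendsto_finsetSum _ fun j _ ↦ ContinuousAt.mul continuousAt_const ?_
  rcases lt_or_gt_of_ne (hs j) with h | h
  · refine ContinuousAt.congr (f := fun s ↦ Real.exp (-l * (t j - s))) (by fun_prop) ?_
    filter_upwards [Iio_mem_nhds h] with u hu
    rw [indicator_of_mem hu]
  · refine ContinuousAt.congr (f := fun _ ↦ (0 : ℝ)) continuousAt_const ?_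
    filter_upwards [Ioi_mem_nhds h] with u hu
    rw [indicator_of_notMem (show u ∉ Iio (t j) from notMem_Iio.2 (mem_Ioi.1 hu).le)]

lemma integrable_ouKernel (hl : 0 < l) (c t : ι → ℝ) : Integrable (ouKernel l c t) := by
  unfold ouKernel
  refine integrable_finsetSum _ fun j _ ↦ Integrable.const_mul ?_ _
  rw [integrable_indicator_iff measurableSet_Iio]
  have := ((integrableOn_exp_mul_Iic hl (t j)).mono_set Iio_subset_Iic_self).const_mul
    (Real.exp (-l * t j))
  refine this.congr (ae_of_all _ fun s ↦ ?_)
  simp only [← Real.exp_add]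
  congr 1; ring

lemma integrable_jumpSymbol_ouKernel (hl : 0 < l) (a : ℝ) (c t : ι → ℝ) :
    Integrable (fun s ↦ jumpSymbol (a * ouKernel l c t s)) := by
  refine ((integrable_ouKernel hl c t).const_mul a).norm.mono' ?_ ?_
  · exact (continuous_jumpSymbol.measurable.comp
      ((measurable_ouKernel l c t).const_mul a)).aestronglyMeasurable
  · exact ae_of_all _ fun s ↦ norm_jumpSymbol_le_abs _

lemma ouKernel_eq_zero {s : ℝ} (h : ∀ j, t j ≤ s) : ouKernel l c t s = 0 := by
  unfold ouKernel
  refine Finset.sum_eq_zero fun j _ ↦ ?_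
  rw [indicator_of_notMem (show s ∉ Iio (t j) from not_lt.2 (h j)), mul_zero]

lemma ouKernel_add (l : ℝ) (c t : ι → ℝ) (h s : ℝ) :
    ouKernel l c (fun j ↦ t j + h) (s + h) = ouKernel l c t s := by
  unfold ouKernel
  refine Finset.sum_congr rfl fun j _ ↦ ?_
  simp [indicator_apply]

/-- Before all the times `t j` the kernel is a single exponential. -/
lemma ouKernel_of_neg (ht : ∀ j, 0 ≤ t j) {s : ℝ} (hs : s < 0) :
    ouKernel l c t s = (∑ j, c j * Real.exp (-l * t j)) * Real.exp (l * s) := by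
  unfold ouKernel
  rw [Finset.sum_mul]
  refine Finset.sum_congr rfl fun j _ ↦ ?_
  rw [indicator_of_mem (show s ∈ Iio (t j) from hs.trans_le (ht j)), mul_assoc, ← Real.exp_add]
  congr 2; ring

end Kernel

/-! ### The Ornstein-Uhlenbeck noise driven by a Poisson process -/

section Noise

variable {Ω : Type*} [MeasurableSpace Ω] {P : Measure Ω} {ρ : ℝ≥0} {a : ℝ} {Z : ℝ≥0 → Ω → ℝ}
  {l : ℝ}

/-- The path of `Z` started from `0`, extended by `0` to negative times. -/
def incrPath (Z : ℝ≥0 → Ω → ℝ) (ω : Ω) (s : ℝ) : ℝ := Z s.toNNReal ω - Z 0 ω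

/-- The stochastic convolution `∫₀ᵗ e ^ (-l (t - s)) dZ(s)`, defined pathwise. -/
noncomputable def ouNoise (l : ℝ) (Z : ℝ≥0 → Ω → ℝ) (t : ℝ) (ω : Ω) : ℝ :=
  Real.exp (-l * t) * expIntegral l (incrPath Z ω) t

omit [MeasurableSpace Ω] in
lemma incrPath_zero (Z : ℝ≥0 → Ω → ℝ) (ω : Ω) : incrPath Z ω 0 = 0 := by simp [incrPath]

omit [MeasurableSpace Ω] in
lemma ouNoise_zero (l : ℝ) (Z : ℝ≥0 → Ω → ℝ) (ω : Ω) : ouNoise l Z 0 ω = 0 := by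
  simp [ouNoise, expIntegral, incrPath_zero]

lemma IsPoissonProcess.ae_incrPath (hZ : IsPoissonProcess ρ a Z P) :
    ∀ᵐ ω ∂P, Monotone (incrPath Z ω) ∧
      ∀ s, ContinuousWithinAt (incrPath Z ω) (Ici s) s := by
  filter_upwards [hZ.paths] with ω hω
  refine ⟨fun u v huv ↦ sub_le_sub_right (hω.1 (Real.toNNReal_le_toNNReal huv)) _, fun s ↦ ?_⟩
  refine ContinuousWithinAt.sub ?_ continuousWithinAt_const
  exact (hω.2 s.toNNReal).comp (t := Ici s.toNNReal) continuous_real_toNNReal.continuousWithinAt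
    fun u hu ↦ Real.toNNReal_le_toNNReal hu

lemma IsPoissonProcess.aemeasurable_incrPath (hZ : IsPoissonProcess ρ a Z P) (s : ℝ) :
    AEMeasurable (fun ω ↦ incrPath Z ω s) P :=
  (hZ.law 0 s.toNNReal (by simp)).aemeasurable

/-- The Riemann sums of the kernel against the increments of `Z` over a grid of mesh `1 / n`
converge pathwise to the linear combination of stochastic convolutions. -/
lemma IsPoissonProcess.ae_tendsto_sum_ouKernel {ι : Type*} [Fintype ι]
    (hZ : IsPoissonProcess ρ a Z P) (hl : 0 ≤ l) {c t : ι → ℝ} (ht : ∀ j, 0 ≤ t j) {T : ℕ}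
    (hT : ∀ j, t j ≤ T) :
    ∀ᵐ ω ∂P, Tendsto (fun n : ℕ ↦ ∑ k ∈ Finset.range (n * T),
        ouKernel l c t (k / n) * (incrPath Z ω ((k + 1) / n) - incrPath Z ω (k / n)))
      atTop (𝓝 (∑ j, c j * ouNoise l Z (t j) ω)) := by
  filter_upwards [hZ.ae_incrPath] with ω hω
  have h1 (j : ι) := (((tendsto_sum_expIntegral hl hω.1 hω.2 (incrPath_zero Z ω) (ht j)).const_mul
    (Real.exp (-l * t j))).const_mul (c j))
  refine (tendsto_finsetSum Finset.univ fun j _ ↦ h1 j).congr' ?_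
  filter_upwards [eventually_gt_atTop 0] with n hn
  have hn' : (0 : ℝ) < n := by exact_mod_cast hn
  simp only [ouKernel, Finset.sum_mul]
  rw [Finset.sum_comm]
  refine Finset.sum_congr rfl fun j _ ↦ ?_
  have hsub : Finset.range ⌈t j * n⌉₊ ⊆ Finset.range (n * T) := by
    refine Finset.range_subset_range.2 (Nat.ceil_le.2 ?_)
    push_cast
    rw [mul_comm]
    exact mul_le_mul_of_nonneg_left (hT j) hn'.le
  have hmem (k : ℕ) : k ∈ Finset.range ⌈t j * n⌉₊ ↔ (k / n : ℝ) ∈ Iio (t j) := by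
    rw [Finset.mem_range, Nat.lt_ceil, mem_Iio, div_lt_iff₀ hn']
  rw [← Finset.sum_subset hsub fun k _ hk ↦ ?_, Finset.mul_sum, Finset.mul_sum]
  · refine Finset.sum_congr rfl fun k hk ↦ ?_
    have hexp : Real.exp (-l * (t j - k / n)) = Real.exp (-l * t j) * Real.exp (l * (k / n)) := by
      rw [← Real.exp_add]; congr 1; ring
    rw [indicator_of_mem ((hmem k).1 hk), hexp]
    ring
  · rw [indicator_of_notMem (fun h ↦ hk ((hmem k).2 h))]
    simp

lemma IsPoissonProcess.aemeasurable_ouNoise (hZ : IsPoissonProcess ρ a Z P) (hl : 0 ≤ l) {t : ℝ}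
    (ht : 0 ≤ t) : AEMeasurable (ouNoise l Z t) P := by
  obtain ⟨T, hT⟩ := exists_nat_ge t
  have := hZ.ae_tendsto_sum_ouKernel hl (c := fun _ : Unit ↦ 1) (t := fun _ ↦ t) (fun _ ↦ ht)
    (T := T) (fun _ ↦ hT)
  refine aemeasurable_of_tendsto_metrizable_ae atTop (fun n ↦ ?_) (by simpa using this)
  refine Finset.aemeasurable_fun_sum _ fun k _ ↦ AEMeasurable.const_mul ?_ _
  exact (hZ.aemeasurable_incrPath _).sub (hZ.aemeasurable_incrPath _)

/-- Characteristic function of a linear combination of increments over a grid. -/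
lemma IsPoissonProcess.integral_cexp_sum_incr (hZ : IsPoissonProcess ρ a Z P) (n K : ℕ)
    (c : ℕ → ℝ) :
    ∫ ω, Complex.exp (Complex.I * ((∑ k ∈ Finset.range K,
        c k * (incrPath Z ω ((k + 1) / n) - incrPath Z ω (k / n)) : ℝ) : ℂ)) ∂P =
      Complex.exp (ρ * ∑ k ∈ Finset.range K, (1 / n : ℝ) • jumpSymbol (a * c k)) := by
  have htn (k : ℕ) : (k / n : ℝ).toNNReal = (k / n : ℝ≥0) := by
    rw [Real.toNNReal_div (by positivity)]; simp
  have hincr (k : ℕ) (ω : Ω) : incrPath Z ω ((k + 1) / n) - incrPath Z ω (k / n) =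
      Z ((k + 1 : ℕ) / n) ω - Z (k / n) ω := by
    have := htn (k + 1)
    push_cast at this ⊢
    simp only [incrPath, htn k, this]
    ring
  have hmono : Monotone (fun k : ℕ ↦ (k / n : ℝ≥0)) := fun i j hij ↦
    div_le_div_of_nonneg_right (Nat.cast_le.2 hij) (by simp)
  have hlaw (k : ℕ) := hZ.law (k / n) ((k + 1 : ℕ) / n) (hmono (Nat.le_succ k))
  have hind := (hZ.indep.nat hmono).comp (fun k x ↦ c k * x) (fun k ↦ by fun_prop)
  have hch := iIndepFun.charFun_map_fun_finsetSum_eq_prod (s := Finset.range K)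
    (X := fun k ω ↦ c k * (Z ((k + 1 : ℕ) / n) ω - Z (k / n) ω))
    (fun k _ ↦ (hlaw k).aemeasurable.const_mul _) (hind.precomp (g := fun i : Finset.range K ↦ (i : ℕ)) Subtype.val_injective)
  have hch1 := congrFun hch 1
  rw [charFun_apply_real, integral_map (Finset.aemeasurable_fun_sum _ fun k _ ↦
    (hlaw k).aemeasurable.const_mul _) (by fun_prop)] at hch1
  simp only [hincr]
  convert hch1 using 1
  · refine integral_congr_ae (ae_of_all _ fun ω ↦ ?_)
    simp only [Complex.ofReal_one, one_mul]
    rw [mul_comm]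
  · rw [Finset.prod_apply, Finset.mul_sum, Complex.exp_sum]
    refine Finset.prod_congr rfl fun k _ ↦ ?_
    rw [charFun_map_mul_comp (hlaw k).aemeasurable, (hlaw k).map_eq]
    have : ((poissonMeasure (ρ * ((k + 1 : ℕ) / n - k / n))).map fun k : ℕ ↦ a * (k : ℝ)) =
        ((poissonMeasure (ρ * ((k + 1 : ℕ) / n - k / n))).map fun k : ℕ ↦ (k : ℝ)).map
          fun x ↦ a * x := by
      rw [Measure.map_map (by fun_prop) (by fun_prop)]; rfl
    rw [this, charFun_map_mul, charFun_map_cast_poissonMeasure]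
    have hsub : ((k + 1 : ℕ) / n - k / n : ℝ≥0) = 1 / n := by
      rw [← NNReal.sub_div]; simp
    rw [hsub, jumpSymbol]
    congr 1
    simp only [Complex.real_smul]
    push_cast
    rw [mul_assoc]
    congr 3
    ring_nf

/-- Joint characteristic function of the stochastic convolutions at the times `t j`. -/
lemma IsPoissonProcess.integral_cexp_sum_ouNoise {ι : Type*} [Fintype ι] [IsProbabilityMeasure P]
    (hZ : IsPoissonProcess ρ a Z P) (hl : 0 ≤ l) {c t : ι → ℝ} (ht : ∀ j, 0 ≤ t j) :
    ∫ ω, Complex.exp (Complex.I * ((∑ j, c j * ouNoise l Z (t j) ω : ℝ) : ℂ)) ∂P =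
      Complex.exp (ρ * ∫ s in Ioi 0, jumpSymbol (a * ouKernel l c t s)) := by
  obtain ⟨T, hT⟩ : ∃ T : ℕ, ∀ j, t j ≤ T := by
    obtain ⟨T, hT⟩ := exists_nat_ge (∑ j, t j)
    exact ⟨T, fun j ↦ (Finset.single_le_sum (fun i _ ↦ ht i) (Finset.mem_univ j)).trans hT⟩
  have hGm : Measurable fun s ↦ jumpSymbol (a * ouKernel l c t s) :=
    continuous_jumpSymbol.measurable.comp ((measurable_ouKernel l c t).const_mul a)
  have hR := tendsto_sum_div_integral hGm (fun s ↦ norm_jumpSymbol_le_two _)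
    (by
      filter_upwards [ae_continuousAt_ouKernel l c t] with s hs
      exact continuous_jumpSymbol.continuousAt.comp (hs.const_mul a)) T
  have hrestr : ∫ s in (0 : ℝ)..T, jumpSymbol (a * ouKernel l c t s) =
      ∫ s in Ioi 0, jumpSymbol (a * ouKernel l c t s) := by
    rw [intervalIntegral.integral_of_le (Nat.cast_nonneg T)]
    refine (setIntegral_eq_of_subset_of_forall_sdiff_eq_zero measurableSet_Ioi Ioc_subset_Ioi_self
      fun s hs ↦ ?_).symm
    have hTs : (T : ℝ) < s := by
      by_contra h
      exact hs.2 ⟨hs.1, not_lt.1 h⟩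
    rw [ouKernel_eq_zero fun j ↦ (hT j).trans hTs.le, mul_zero, jumpSymbol_zero]
  rw [hrestr] at hR
  have hlim := (Complex.continuous_exp.tendsto _).comp (hR.const_mul (ρ : ℂ))
  have hdom : Tendsto (fun n : ℕ ↦ ∫ ω, Complex.exp (Complex.I * ((∑ k ∈ Finset.range (n * T),
        ouKernel l c t (k / n) * (incrPath Z ω ((k + 1) / n) - incrPath Z ω (k / n)) : ℝ) : ℂ)) ∂P)
      atTop (𝓝 (∫ ω, Complex.exp
        (Complex.I * ((∑ j, c j * ouNoise l Z (t j) ω : ℝ) : ℂ)) ∂P)) := by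
    refine tendsto_integral_of_dominated_convergence (fun _ ↦ 1) (fun n ↦ ?_)
      (integrable_const _) (fun n ↦ ae_of_all _ fun ω ↦ ?_) ?_
    · have : AEMeasurable (fun ω ↦ ∑ k ∈ Finset.range (n * T), ouKernel l c t (k / n) *
          (incrPath Z ω ((k + 1) / n) - incrPath Z ω (k / n))) P :=
        Finset.aemeasurable_fun_sum _ fun k _ ↦
          ((hZ.aemeasurable_incrPath _).sub (hZ.aemeasurable_incrPath _)).const_mul _
      exact (Complex.measurable_exp.comp_aemeasurable
        ((Complex.measurable_ofReal.comp_aemeasurable this).const_mul _)).aestronglyMeasurable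
    · rw [Complex.norm_exp_I_mul_ofReal]
    · filter_upwards [hZ.ae_tendsto_sum_ouKernel hl (c := c) ht hT] with ω hω
      have hcont : Continuous fun x : ℝ ↦ Complex.exp (Complex.I * (x : ℂ)) := by fun_prop
      exact (hcont.tendsto _).comp hω
  refine tendsto_nhds_unique hdom (hlim.congr' ?_)
  filter_upwards with n
  exact (hZ.integral_cexp_sum_incr n (n * T) fun k ↦ ouKernel l c t (k / n)).symm

end Noise

/-! ### The characteristic function of the generalised Dickman law -/

lemma setIntegral_Ioi_comp_add_right (f : ℝ → ℂ) (b h : ℝ) :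
    ∫ s in Ioi b, f (s + h) = ∫ s in Ioi (b + h), f s := by
  have := (measurePreserving_add_right volume h).setIntegral_preimage_emb
    (measurableEmbedding_addRight h) f (Ioi (b + h))
  rwa [preimage_add_const_Ioi, add_sub_cancel_right] at this

/-- The logarithm, up to the factor `θ`, of the characteristic function of `GD(θ, a)`. It is the
usual integral of `(e ^ (i a u v) - 1) / v` over `v` in `(0, 1)`, written in the variable `s` with
`v = e ^ (-s)`. -/
noncomputable def dickmanExponent (a u : ℝ) : ℂ :=
  ∫ s in Ioi (0 : ℝ), jumpSymbol (a * (u * Real.exp (-s)))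

lemma integrableOn_jumpSymbol_exp (a u b : ℝ) :
    IntegrableOn (fun s ↦ jumpSymbol (a * (u * Real.exp (-s)))) (Ioi b) := by
  refine (((integrableOn_exp_neg_Ioi b).const_mul (a * u)).norm).mono'
    (Continuous.aestronglyMeasurable (by fun_prop)) (ae_of_all _ fun s ↦ ?_)
  simpa [mul_assoc] using norm_jumpSymbol_le_abs (a * (u * Real.exp (-s)))

lemma norm_dickmanExponent_le (a u : ℝ) : ‖dickmanExponent a u‖ ≤ |a * u| := by
  calc ‖dickmanExponent a u‖ ≤ ∫ s in Ioi (0 : ℝ), |a * u| * Real.exp (-s) := by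
        refine norm_integral_le_of_norm_le ((integrableOn_exp_neg_Ioi 0).const_mul _)
          (ae_of_all _ fun s ↦ (norm_jumpSymbol_le_abs _).trans_eq ?_)
        rw [← mul_assoc, abs_mul, abs_of_pos (Real.exp_pos _)]
    _ = |a * u| := by rw [integral_const_mul, integral_exp_neg_Ioi_zero, mul_one]

lemma re_jumpSymbol (x : ℝ) : (jumpSymbol x).re = Real.cos x - 1 := by
  simp [jumpSymbol, mul_comm Complex.I, Complex.exp_ofReal_mul_I_re]

lemma re_dickmanExponent (a u : ℝ) : (dickmanExponent a u).re =
    ∫ s in Ioi (0 : ℝ), (Real.cos (a * (u * Real.exp (-s))) - 1) := by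
  have := integral_re (integrableOn_jumpSymbol_exp a u 0)
  simp only [RCLike.re_eq_complex_re, re_jumpSymbol] at this
  exact this.symm

lemma re_dickmanExponent_nonpos (a u : ℝ) : (dickmanExponent a u).re ≤ 0 := by
  rw [re_dickmanExponent]
  exact integral_nonpos fun s ↦ sub_nonpos.2 (Real.cos_le_one _)

lemma le_re_dickmanExponent (a u : ℝ) : -(a * u) ^ 2 ≤ (dickmanExponent a u).re := by
  have h1 : IntegrableOn (fun s : ℝ ↦ -(a * u) ^ 2 * Real.exp (-s)) (Ioi 0) :=
    (integrableOn_exp_neg_Ioi 0).const_mul _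
  have h2 : IntegrableOn (fun s ↦ Real.cos (a * (u * Real.exp (-s))) - 1) (Ioi 0) := by
    have := (integrableOn_jumpSymbol_exp a u 0).re
    simp only [RCLike.re_eq_complex_re, re_jumpSymbol] at this
    exact this
  have h3 : -(a * u) ^ 2 = ∫ s in Ioi (0 : ℝ), -(a * u) ^ 2 * Real.exp (-s) := by
    rw [integral_const_mul, integral_exp_neg_Ioi_zero, mul_one]
  rw [re_dickmanExponent, h3]
  refine setIntegral_mono_on h1 h2 measurableSet_Ioi fun s hs ↦ ?_
  have h4 := Real.one_sub_sq_div_two_le_cos (x := a * (u * Real.exp (-s)))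
  have h5 : Real.exp (-s) ≤ 1 := Real.exp_le_one_iff.2 (by linarith [mem_Ioi.1 hs])
  have h6 : 0 < Real.exp (-s) := Real.exp_pos _
  have h7 : (a * (u * Real.exp (-s))) ^ 2 = (a * u) ^ 2 * Real.exp (-s) ^ 2 := by ring
  have h8 : Real.exp (-s) ^ 2 ≤ Real.exp (-s) := by nlinarith
  have h9 := mul_le_mul_of_nonneg_left h8 (sq_nonneg (a * u))
  have h10 : 0 ≤ (a * u) ^ 2 * Real.exp (-s) := by positivity
  rw [h7] at h4
  linarith

/-- The characteristic function of `GD(θ, a)`. -/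
noncomputable def dickmanCharFun (θ a u : ℝ) : ℂ := Complex.exp (θ * dickmanExponent a u)

lemma continuousAt_dickmanCharFun_zero (θ a : ℝ) : ContinuousAt (dickmanCharFun θ a) 0 := by
  have : ContinuousAt (dickmanExponent a) 0 := by
    have h0 : dickmanExponent a 0 = 0 := by simp [dickmanExponent]
    rw [ContinuousAt, h0]
    refine squeeze_zero_norm (norm_dickmanExponent_le a) ?_
    have : Continuous fun u : ℝ ↦ |a * u| := by fun_prop
    simpa using this.tendsto 0
  unfold dickmanCharFun
  fun_prop

/-- Near the origin the real part of the characteristic function is quadratically close to `1`;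
this is what makes the Dickman law square integrable. -/
lemma one_sub_re_dickmanCharFun_le {θ : ℝ} (hθ : 0 ≤ θ) (a u : ℝ) :
    1 - (dickmanCharFun θ a u).re ≤ (θ * a ^ 2 + (θ * a) ^ 2 / 2) * u ^ 2 := by
  set A := θ * (dickmanExponent a u).re with hA
  set B := θ * (dickmanExponent a u).im with hB
  have hre : (dickmanCharFun θ a u).re = Real.exp A * Real.cos B := by
    rw [dickmanCharFun, Complex.exp_re]
    simp [hA, hB]
  have hA0 : A ≤ 0 := mul_nonpos_of_nonneg_of_nonpos hθ (re_dickmanExponent_nonpos a u)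
  have hA1 : -(θ * (a * u) ^ 2) ≤ A := by
    have := mul_le_mul_of_nonneg_left (le_re_dickmanExponent a u) hθ
    linarith
  have hB1 : B ^ 2 ≤ (θ * (a * u)) ^ 2 := by
    rw [← sq_abs B, hB, abs_mul, mul_pow, mul_pow, sq_abs]
    refine mul_le_mul_of_nonneg_left ?_ (sq_nonneg θ)
    rw [← sq_abs (a * u)]
    exact pow_le_pow_left₀ (abs_nonneg _)
      ((Complex.abs_im_le_norm _).trans (norm_dickmanExponent_le a u)) 2
  have h1 : 1 + A ≤ Real.exp A := by linarith [Real.add_one_le_exp A]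
  have h2 : Real.exp A ≤ 1 := Real.exp_le_one_iff.2 hA0
  have h3 := mul_le_mul_of_nonneg_left (Real.one_sub_sq_div_two_le_cos (x := B))
    (Real.exp_pos A).le
  have h4 := mul_le_mul_of_nonneg_right h2 (by positivity : 0 ≤ B ^ 2 / 2)
  rw [hre]
  nlinarith

/-- Scaling the argument by `e ^ (-s)` removes the part of the exponent below `s`. -/
lemma dickmanExponent_mul_exp (a u s : ℝ) :
    dickmanExponent a (u * Real.exp (-s)) =
      dickmanExponent a u - ∫ r in (0 : ℝ)..s, jumpSymbol (a * (u * Real.exp (-r))) := by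
  have h1 : dickmanExponent a (u * Real.exp (-s)) =
      ∫ r in Ioi s, jumpSymbol (a * (u * Real.exp (-r))) := by
    have := setIntegral_Ioi_comp_add_right (fun r ↦ jumpSymbol (a * (u * Real.exp (-r)))) 0 s
    rw [zero_add] at this
    rw [← this, dickmanExponent]
    refine integral_congr_ae (ae_of_all _ fun r ↦ ?_)
    simp only [neg_add, Real.exp_add]
    ring_nf
  rw [h1, eq_sub_iff_add_eq', dickmanExponent]
  exact intervalIntegral.integral_interval_add_Ioi (integrableOn_jumpSymbol_exp a u 0)
    (integrableOn_jumpSymbol_exp a u s)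

lemma hasDerivAt_exp_mul_dickmanCharFun (θ a u s : ℝ) :
    HasDerivAt (fun s : ℝ ↦ (Real.exp (-θ * s) : ℂ) * dickmanCharFun θ a (u * Real.exp (-s)))
      (-((θ * Real.exp (-θ * s) : ℝ) : ℂ) * (Complex.exp (Complex.I * (a * (u * Real.exp (-s)) : ℝ)) *
        dickmanCharFun θ a (u * Real.exp (-s)))) s := by
  have h1 : HasDerivAt (fun s : ℝ ↦ (Real.exp (-θ * s) : ℂ))
      ((Real.exp (-θ * s) * (-θ * 1) : ℝ) : ℂ) s :=
    (((hasDerivAt_id s).const_mul (-θ)).exp).ofReal_comp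
  have h2 : HasDerivAt (fun s : ℝ ↦ dickmanExponent a (u * Real.exp (-s)))
      (-jumpSymbol (a * (u * Real.exp (-s)))) s := by
    simp only [dickmanExponent_mul_exp]
    exact (intervalIntegral.integral_hasDerivAt_right
      (Continuous.intervalIntegrable (by fun_prop) _ _)
      (Continuous.stronglyMeasurableAtFilter (by fun_prop) _ _)
      (Continuous.continuousAt (by fun_prop))).const_sub _
  refine (h1.mul (h2.const_mul (θ : ℂ)).cexp).congr_deriv ?_
  simp only [dickmanCharFun, jumpSymbol]
  push_cast
  ring

/-- The change of variables `w = e ^ (-θ s)`, under which `w ^ (1 / θ) = e ^ (-s)`. -/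
lemma setIntegral_rpow_eq_integral_exp {θ : ℝ} (hθ : 0 < θ) (h : ℝ → ℂ) :
    ∫ w in Ioc (0 : ℝ) 1, h (w ^ (1 / θ)) =
      ∫ s in Ioi (0 : ℝ), ((θ * Real.exp (-θ * s) : ℝ) : ℂ) * h (Real.exp (-s)) := by
  have himage : (fun s ↦ Real.exp (-θ * s)) '' Ici (0 : ℝ) = Ioc 0 1 := by
    ext w
    constructor
    · rintro ⟨s, hs, rfl⟩
      exact ⟨Real.exp_pos _, Real.exp_le_one_iff.2 (by nlinarith [mem_Ici.1 hs])⟩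
    · rintro ⟨hw0, hw1⟩
      refine ⟨-Real.log w / θ, div_nonneg (neg_nonneg.2 (Real.log_nonpos hw0.le hw1)) hθ.le, ?_⟩
      have : -θ * (-Real.log w / θ) = Real.log w := by field_simp
      simp only [this, Real.exp_log hw0]
  have hder (s : ℝ) (_ : s ∈ Ici (0 : ℝ)) :
      HasDerivWithinAt (fun s ↦ Real.exp (-θ * s)) (Real.exp (-θ * s) * (-θ * 1)) (Ici 0) s :=
    (((hasDerivAt_id s).const_mul (-θ)).exp).hasDerivWithinAt
  have hinj : InjOn (fun s ↦ Real.exp (-θ * s)) (Ici (0 : ℝ)) := fun x _ y _ hxy ↦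
    mul_left_cancel₀ (neg_ne_zero.2 hθ.ne') (Real.exp_injective hxy)
  rw [← himage, integral_image_eq_integral_abs_deriv_smul measurableSet_Ici hder hinj,
    integral_Ici_eq_integral_Ioi]
  refine integral_congr_ae (ae_of_all _ fun s ↦ ?_)
  have h1 : |Real.exp (-θ * s) * (-θ * 1)| = θ * Real.exp (-θ * s) := by
    rw [mul_one, mul_neg, abs_neg, abs_of_pos (by positivity), mul_comm]
  have h2 : Real.exp (-θ * s) ^ (1 / θ) = Real.exp (-s) := by
    rw [← Real.exp_mul]
    congr 1
    field_simp
  simp only [h1, h2, Complex.real_smul]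

/-- Solving the fixed point equation on the level of characteristic functions: it says that
`e ^ (-θ s) φ(u e ^ (-s))` is minus the integral of its derivative over `(s, ∞)`. -/
lemma isGenDickman_of_charFun {θ : ℝ≥0} (hθ : 0 < θ) {a : ℝ} {μ : Measure ℝ}
    [IsProbabilityMeasure μ] (hμ : ∀ u, charFun μ u = dickmanCharFun θ a u) :
    IsGenDickman θ a μ := by
  have hθ' : (0 : ℝ) < θ := hθ
  refine ⟨inferInstance, ?_⟩
  have hmeas : Measurable (fun p : ℝ × ℝ ↦ p.1 ^ (1 / (θ : ℝ)) * (a + p.2)) := by fun_prop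
  have hnorm (u : ℝ) : ‖dickmanCharFun θ a u‖ ≤ 1 := hμ u ▸ norm_charFun_le_one u
  refine Measure.ext_of_charFun (funext fun u ↦ ?_)
  rw [charFun_apply_real, integral_map hmeas.aemeasurable (by fun_prop), integral_prod _ ?_]
  swap
  · refine (integrable_const (1 : ℝ)).mono' (by fun_prop) (ae_of_all _ fun p ↦ ?_)
    rw [← Complex.ofReal_mul, Complex.norm_exp_ofReal_mul_I]
  set h : ℝ → ℂ := fun v ↦
    Complex.exp (Complex.I * (a * (u * v) : ℝ)) * dickmanCharFun θ a (u * v) with hh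
  have hinner (w : ℝ) :
      ∫ x, Complex.exp (u * ((w ^ (1 / (θ : ℝ)) * (a + x) : ℝ) : ℂ) * Complex.I) ∂μ =
        h (w ^ (1 / (θ : ℝ))) := by
    rw [hh]
    simp only
    rw [← hμ, charFun_apply_real, ← integral_const_mul]
    refine integral_congr_ae (ae_of_all _ fun x ↦ ?_)
    simp only
    rw [← Complex.exp_add]
    congr 1
    push_cast
    ring
  simp only [hinner]
  rw [setIntegral_rpow_eq_integral_exp hθ' h, hμ]
  have hexp : IntegrableOn (fun s : ℝ ↦ (θ : ℝ) * Real.exp (-θ * s)) (Ioi 0) :=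
    (integrableOn_exp_mul_Ioi (neg_lt_zero.2 hθ') 0).const_mul _
  have hlim : Tendsto (fun s : ℝ ↦ (Real.exp (-θ * s) : ℂ) *
      dickmanCharFun θ a (u * Real.exp (-s))) atTop (𝓝 0) := by
    refine squeeze_zero_norm (a := fun s : ℝ ↦ Real.exp (-θ * s)) (fun s ↦ ?_) ?_
    · rw [norm_mul, Complex.norm_real, Real.norm_eq_abs, abs_of_pos (Real.exp_pos _)]
      exact mul_le_of_le_one_right (Real.exp_pos _).le (hnorm _)
    · refine Real.tendsto_exp_atBot.comp ?_
      exact tendsto_id.const_mul_atTop_of_neg (neg_lt_zero.2 hθ')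
  have hcφ : Continuous (dickmanCharFun θ a) := by
    rw [show dickmanCharFun θ a = charFun μ from (funext hμ).symm]; fun_prop
  have hint : IntegrableOn (fun s : ℝ ↦ -(((θ : ℝ) * Real.exp (-θ * s) : ℝ) : ℂ) *
      h (Real.exp (-s))) (Ioi 0) := by
    refine hexp.mono' (Continuous.aestronglyMeasurable (by fun_prop)) (ae_of_all _ fun s ↦ ?_)
    rw [hh, norm_mul, norm_neg, Complex.norm_real, Real.norm_eq_abs, abs_of_pos (by positivity),
      norm_mul, Complex.norm_exp_I_mul_ofReal, one_mul]
    exact mul_le_of_le_one_right (by positivity) (hnorm _)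
  have key := integral_Ioi_of_hasDerivAt_of_tendsto'
    (fun s _ ↦ hasDerivAt_exp_mul_dickmanCharFun θ a u s) hint hlim
  simp only [neg_mul, integral_neg] at key
  simp only [hh]
  simpa using key

/-- Fatou's lemma applied to `n² (1 - cos (x / n))`, whose integrals are bounded by
`one_sub_re_dickmanCharFun_le`. -/
lemma memLp_two_of_charFun {θ : ℝ} (hθ : 0 ≤ θ) {a : ℝ} {μ : Measure ℝ}
    [IsProbabilityMeasure μ] (hμ : ∀ u, charFun μ u = dickmanCharFun θ a u) :
    MemLp id 2 μ := by
  set C := θ * a ^ 2 + (θ * a) ^ 2 / 2 with hC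
  have hre (u : ℝ) : ∫ x, (1 - Real.cos (u * x)) ∂μ = 1 - (dickmanCharFun θ a u).re := by
    have hi : Integrable (fun x : ℝ ↦ Complex.exp (u * x * Complex.I)) μ := by
      refine (integrable_const (1 : ℝ)).mono' (by fun_prop) (ae_of_all _ fun p ↦ ?_)
      rw [← Complex.ofReal_mul, Complex.norm_exp_ofReal_mul_I]
    have h1 := integral_re hi
    simp only [RCLike.re_eq_complex_re] at h1
    rw [← charFun_apply_real, hμ] at h1
    simp only [← Complex.ofReal_mul, Complex.exp_ofReal_mul_I_re] at h1
    have hi' := hi.re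
    simp only [RCLike.re_eq_complex_re, ← Complex.ofReal_mul, Complex.exp_ofReal_mul_I_re] at hi'
    rw [integral_sub (integrable_const _) hi', h1]
    simp
  -- the integrands `n² (1 - cos (x / n))` dominate `2 / π² x²` for large `n`
  set F : ℕ → ℝ → ENNReal := fun n x ↦ ENNReal.ofReal ((n : ℝ) ^ 2 * (1 - Real.cos (1 / n * x)))
  have hFint (n : ℕ) : ∫⁻ x, F n x ∂μ ≤ ENNReal.ofReal C := by
    rw [← ofReal_integral_eq_lintegral_ofReal]
    · refine ENNReal.ofReal_le_ofReal ?_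
      rw [integral_const_mul, hre]
      refine (mul_le_mul_of_nonneg_left (one_sub_re_dickmanCharFun_le hθ a (1 / n))
        (sq_nonneg _)).trans ?_
      rcases eq_or_ne (n : ℝ) 0 with h0 | h0
      · rw [h0]; simp only [hC]; norm_num; positivity
      · rw [← hC]; field_simp; rfl
    · refine (((integrable_const (2 : ℝ)).mono' (by fun_prop) (ae_of_all _ fun x ↦ ?_)).const_mul _)
      rw [Real.norm_eq_abs, abs_le]
      constructor <;> linarith [Real.cos_le_one (1 / n * x), Real.neg_one_le_cos (1 / n * x)]
    · exact ae_of_all _ fun x ↦ mul_nonneg (sq_nonneg _) (sub_nonneg.2 (Real.cos_le_one _))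
  have hlow (x : ℝ) : ENNReal.ofReal (2 / Real.pi ^ 2 * x ^ 2) ≤
      liminf (fun n ↦ F n x) atTop := by
    refine le_liminf_of_le (by isBoundedDefault) ?_
    filter_upwards [eventually_gt_atTop 0, eventually_ge_atTop ⌈|x| / Real.pi⌉₊] with n hn hnx
    have hn' : (0 : ℝ) < n := by exact_mod_cast hn
    refine ENNReal.ofReal_le_ofReal ?_
    have h1 : |1 / n * x| ≤ Real.pi := by
      rw [abs_mul, abs_of_pos (by positivity), one_div, inv_mul_le_iff₀ hn',
        ← div_le_iff₀ Real.pi_pos]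
      exact (Nat.le_ceil _).trans (by exact_mod_cast hnx)
    have h2 := Real.cos_le_one_sub_mul_cos_sq h1
    have h3 : (n : ℝ) ^ 2 * (2 / Real.pi ^ 2 * (1 / n * x) ^ 2) = 2 / Real.pi ^ 2 * x ^ 2 := by
      field_simp
    rw [← h3]
    exact mul_le_mul_of_nonneg_left (by linarith) (sq_nonneg _)
  have hfin : ∫⁻ x, ENNReal.ofReal (2 / Real.pi ^ 2 * x ^ 2) ∂μ < ⊤ := by
    refine lt_of_le_of_lt (lintegral_mono hlow) ?_
    refine lt_of_le_of_lt (lintegral_liminf_le fun n ↦ by fun_prop) ?_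
    refine lt_of_le_of_lt (liminf_le_of_frequently_le' (Frequently.of_forall hFint))
      ENNReal.ofReal_lt_top
  have hi : Integrable (fun x : ℝ ↦ 2 / Real.pi ^ 2 * x ^ 2) μ := by
    refine (lintegral_ofReal_ne_top_iff_integrable (by fun_prop)
      (ae_of_all _ fun x ↦ by positivity)).1 hfin.ne
  rw [memLp_two_iff_integrable_sq (by fun_prop)]
  exact (integrable_const_mul_iff (isUnit_iff_ne_zero.2 (by positivity)) _).1 hi

lemma integral_rpow_Ioc {p : ℝ} (hp : 0 ≤ p) :
    ∫ w in Ioc (0 : ℝ) 1, w ^ p = 1 / (p + 1) := by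
  rw [← intervalIntegral.integral_of_le zero_le_one, integral_rpow (Or.inl (by linarith)),
    Real.one_rpow, Real.zero_rpow (by linarith), sub_zero]

/-- The first two moments follow from the distributional fixed point equation. -/
lemma IsGenDickman.variance_eq {θ : ℝ≥0} (hθ : 0 < θ) {a : ℝ} {μ : Measure ℝ}
    (h : IsGenDickman θ a μ) (h2 : MemLp id 2 μ) : variance id μ = a ^ 2 * (θ / 2) := by
  have hθ' : (0 : ℝ) < θ := hθ
  have := h.1
  have hmeas : Measurable (fun p : ℝ × ℝ ↦ p.1 ^ (1 / (θ : ℝ)) * (a + p.2)) := by fun_prop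
  have hi1 : Integrable (fun x : ℝ ↦ x) μ := h2.integrable one_le_two
  have hi2 : Integrable (fun x : ℝ ↦ x ^ 2) μ := h2.integrable_sq
  set m := ∫ x, x ∂μ with hm
  set q := ∫ x, x ^ 2 ∂μ with hq
  have e1 : m = 1 / (1 / (θ : ℝ) + 1) * (a + m) := by
    conv_lhs => rw [hm, ← h.2]
    rw [integral_map hmeas.aemeasurable (by fun_prop),
      integral_prod_mul (fun w : ℝ ↦ w ^ (1 / (θ : ℝ))) (fun x ↦ a + x),
      integral_rpow_Ioc (by positivity), integral_add (integrable_const _) hi1]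
    simp [hm]
  have e2 : q = 1 / (2 / (θ : ℝ) + 1) * (a ^ 2 + 2 * a * m + q) := by
    conv_lhs => rw [hq, ← h.2]
    rw [integral_map hmeas.aemeasurable (by fun_prop)]
    simp only [mul_pow]
    rw [integral_prod_mul (fun w : ℝ ↦ (w ^ (1 / (θ : ℝ))) ^ 2) (fun x ↦ (a + x) ^ 2)]
    have hpow : ∫ w in Ioc (0 : ℝ) 1, (w ^ (1 / (θ : ℝ))) ^ 2 =
        ∫ w in Ioc (0 : ℝ) 1, w ^ (2 / (θ : ℝ)) := by
      refine setIntegral_congr_fun measurableSet_Ioc fun w hw ↦ ?_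
      rw [← Real.rpow_natCast, ← Real.rpow_mul hw.1.le]
      congr 1
      push_cast; ring
    have hsq : ∫ x, (a + x) ^ 2 ∂μ = a ^ 2 + 2 * a * m + q := by
      have hi1' : Integrable (fun x : ℝ ↦ a ^ 2 + 2 * a * x) μ :=
        (integrable_const _).add (hi1.const_mul _)
      simp only [add_sq]
      rw [integral_add hi1' hi2, integral_add (integrable_const _) (hi1.const_mul _),
        integral_const_mul]
      simp [hm, hq]
    rw [hpow, integral_rpow_Ioc (by positivity), hsq]
  rw [variance_eq_sub h2]
  simp only [Pi.pow_apply, id_eq]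
  rw [← hm, ← hq]
  have e1' : m = θ * a := by
    field_simp at e1
    linarith
  rw [e1'] at e2 ⊢
  field_simp at e2
  nlinarith

/-- Lévy's continuity theorem: a pointwise limit of characteristic functions that is continuous at
the origin is a characteristic function. -/
lemma exists_charFun_eq_of_tendsto {μ : ℕ → Measure ℝ} [∀ n, IsProbabilityMeasure (μ n)]
    {f : ℝ → ℂ} (hf : ContinuousAt f 0)
    (h : ∀ u, Tendsto (fun n ↦ charFun (μ n) u) atTop (𝓝 (f u))) :
    ∃ ν : Measure ℝ, IsProbabilityMeasure ν ∧ ∀ u, charFun ν u = f u := by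
  have htight := isTightMeasureSet_of_tendsto_charFun hf h
  set p : ℕ → ProbabilityMeasure ℝ := fun n ↦ ⟨μ n, inferInstance⟩
  have hcomp : IsCompact (closure (range p)) := by
    refine isCompact_closure_of_isTightMeasureSet ?_
    convert htight
    ext ν
    exact ⟨fun ⟨_, ⟨n, hn⟩, h⟩ ↦ ⟨n, by rw [← h, ← hn]; rfl⟩,
      fun ⟨n, hn⟩ ↦ ⟨p n, mem_range_self n, hn⟩⟩
  obtain ⟨ν, -, hν⟩ := hcomp.exists_mapClusterPt (f := atTop) (u := p)
    (tendsto_principal.2 (Eventually.of_forall fun n ↦ subset_closure (mem_range_self n)))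
  refine ⟨ν, inferInstance, fun u ↦ ?_⟩
  have hcont : Continuous fun q : ProbabilityMeasure ℝ ↦ charFun (q : Measure ℝ) u := by
    simp_rw [charFun_eq_integral_innerProbChar]
    refine continuous_iff_continuousAt.2 fun q ↦ ?_
    exact (ProbabilityMeasure.tendsto_iff_forall_integral_rclike_tendsto ℂ).1 tendsto_id _
  have hc := hν.continuousAt_comp hcont.continuousAt
  obtain ⟨U, hU, hU'⟩ := mapClusterPt_iff_ultrafilter.1 hc
  exact tendsto_nhds_unique hU' ((h u).mono_left hU)

/-! ### The stationary exponent -/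

section StationaryExponent

variable {ι : Type*} [Fintype ι] {l : ℝ} {c t : ι → ℝ}

/-- The exponent, per unit of jump intensity, of the joint characteristic function of the
stationary process at the times `t j`: the kernel is integrated against a noise on the whole
line. -/
noncomputable def stationaryExponent (a l : ℝ) (c t : ι → ℝ) : ℂ :=
  ∫ s, jumpSymbol (a * ouKernel l c t s)

lemma stationaryExponent_add (a l : ℝ) (c t : ι → ℝ) (h : ℝ) :
    stationaryExponent a l c (fun j ↦ t j + h) = stationaryExponent a l c t := by
  have := integral_add_right_eq_self (μ := volume)
    (fun s ↦ jumpSymbol (a * ouKernel l c (fun j ↦ t j + h) s)) h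
  rw [stationaryExponent, ← this]
  simp only [ouKernel_add]
  rfl

lemma mul_integral_Iio_jumpSymbol (hl : 0 < l) (a v : ℝ) :
    l * ∫ s in Iio (0 : ℝ), jumpSymbol (a * (v * Real.exp (l * s))) = dickmanExponent a v := by
  have h1 := integral_comp_neg_Ioi 0 fun s ↦ jumpSymbol (a * (v * Real.exp (l * s)))
  have h2 := integral_comp_mul_left_Ioi (fun s ↦ jumpSymbol (a * (v * Real.exp (-s)))) 0 hl
  simp only [mul_neg, mul_zero, neg_zero] at h1 h2
  rw [← integral_Iic_eq_integral_Iio, ← h1, h2, dickmanExponent, Complex.real_smul, ← mul_assoc,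
    Complex.ofReal_inv, mul_inv_cancel₀ (Complex.ofReal_ne_zero.2 hl.ne'), one_mul]

/-- The noise before time `0` contributes the exponent of a Dickman initial value. -/
lemma mul_stationaryExponent (hl : 0 < l) (a : ℝ) (ht : ∀ j, 0 ≤ t j) :
    l * stationaryExponent a l c t = dickmanExponent a (∑ j, c j * Real.exp (-l * t j)) +
      l * ∫ s in Ioi 0, jumpSymbol (a * ouKernel l c t s) := by
  have hint := integrable_jumpSymbol_ouKernel hl a c t
  rw [stationaryExponent, ← intervalIntegral.integral_Iic_add_Ioi hint.integrableOn
    hint.integrableOn (b := 0), mul_add, integral_Iic_eq_integral_Iio,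
    ← mul_integral_Iio_jumpSymbol hl]
  congr 2
  refine setIntegral_congr_fun measurableSet_Iio fun s hs ↦ ?_
  simp only [ouKernel_of_neg ht hs]

lemma mul_stationaryExponent_unit (hl : 0 < l) (a u s : ℝ) :
    l * stationaryExponent a l (fun _ : Unit ↦ u) (fun _ ↦ s) = dickmanExponent a u := by
  have h0 := stationaryExponent_add a l (fun _ : Unit ↦ u) (fun _ ↦ 0) s
  simp only [zero_add] at h0
  rw [h0, mul_stationaryExponent hl a fun _ ↦ le_rfl]
  have : ∫ s in Ioi 0, jumpSymbol (a * ouKernel l (fun _ : Unit ↦ u) (fun _ ↦ 0) s) = 0 := by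
    refine setIntegral_eq_zero_of_forall_eq_zero fun s hs ↦ ?_
    rw [ouKernel_eq_zero fun _ ↦ (mem_Ioi.1 hs).le, mul_zero, jumpSymbol_zero]
  simp [this]

lemma tendsto_integral_Ioi_ouKernel (hl : 0 < l) (a : ℝ) (c t : ι → ℝ) :
    Tendsto (fun n : ℕ ↦ ∫ s in Ioi 0, jumpSymbol (a * ouKernel l c (fun j ↦ t j + n) s)) atTop
      (𝓝 (stationaryExponent a l c t)) := by
  have h1 (n : ℕ) : ∫ s in Ioi (-(n : ℝ)), jumpSymbol (a * ouKernel l c t s) =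
      ∫ s in Ioi 0, jumpSymbol (a * ouKernel l c (fun j ↦ t j + n) s) := by
    have := setIntegral_Ioi_comp_add_right
      (fun s ↦ jumpSymbol (a * ouKernel l c (fun j ↦ t j + n) s)) (-n) n
    simpa only [ouKernel_add, neg_add_cancel] using this
  refine Tendsto.congr h1 ?_
  exact (aecover_Ioi (tendsto_neg_atTop_atBot.comp
    tendsto_natCast_atTop_atTop)).integral_tendsto_of_countably_generated
    (integrable_jumpSymbol_ouKernel hl a c t)

/-- The kernels of `X(t)` and of the innovation `X(t + τ) - e ^ (-l τ) X(t)` have disjoint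
supports, so their exponents add up. -/
lemma stationaryExponent_innovation (hl : 0 < l) (a u v : ℝ) {t τ : ℝ} (hτ : 0 ≤ τ) :
    stationaryExponent a l ![u - v * Real.exp (-l * τ), v] ![t, t + τ] =
      stationaryExponent a l ![u, 0] ![t, t + τ] +
        stationaryExponent a l ![-v * Real.exp (-l * τ), v] ![t, t + τ] := by
  simp only [stationaryExponent]
  rw [← integral_add (integrable_jumpSymbol_ouKernel hl a _ _)
    (integrable_jumpSymbol_ouKernel hl a _ _)]
  refine integral_congr_ae (ae_of_all _ fun s ↦ ?_)
  simp only [ouKernel, Fin.sum_univ_two, Matrix.cons_val_zero, Matrix.cons_val_one]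
  rcases lt_or_ge s t with h | h
  · have h' : s < t + τ := by linarith
    have hexp : Real.exp (-l * (t + τ - s)) = Real.exp (-l * τ) * Real.exp (-l * (t - s)) := by
      rw [← Real.exp_add]; congr 1; ring
    rw [indicator_of_mem (mem_Iio.2 h), indicator_of_mem (mem_Iio.2 h'), hexp]
    have h0 : -v * Real.exp (-l * τ) * Real.exp (-l * (t - s)) +
        v * (Real.exp (-l * τ) * Real.exp (-l * (t - s))) = 0 := by ring
    rw [h0, mul_zero, jumpSymbol_zero, add_zero]
    congr 1; ring
  · rw [indicator_of_notMem (notMem_Iio.2 h)]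
    simp

end StationaryExponent

/-! ### Stationary solutions -/

section Solutions

variable {Ω : Type*} [MeasurableSpace Ω] {P : Measure Ω} {θ lam : ℝ≥0} {a : ℝ}
  {N X : ℝ≥0 → Ω → ℝ}

lemma IsPoissonProcess.comp_mul (hN : IsPoissonProcess θ a N P) (lam : ℝ≥0) :
    IsPoissonProcess (θ * lam) a (fun t ↦ N (lam * t)) P where
  zero := by simpa using hN.zero
  indep n t ht := hN.indep n (fun i ↦ lam * t i) fun i j hij ↦ mul_le_mul_right (ht hij) lam
  law s t hst := by
    have := hN.law (lam * s) (lam * t) (mul_le_mul_right hst lam)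
    rwa [← mul_tsub, ← mul_assoc] at this
  paths := by
    filter_upwards [hN.paths] with ω hω
    refine ⟨fun s t hst ↦ hω.1 (mul_le_mul_right hst lam), fun t ↦ ?_⟩
    exact (hω.2 (lam * t)).comp (t := Ici (lam * t)) (by fun_prop)
      fun u hu ↦ mul_le_mul_right (mem_Ici.1 hu) lam

/-- Every solution is its initial value, discounted, plus the stochastic convolution. -/
lemma IsOUSolution.ae_eq (hX : IsOUSolution lam N X P) (hN : IsPoissonProcess θ a N P) :
    ∀ᵐ ω ∂P, ∀ t : ℝ≥0, X t ω = Real.exp (-lam * t) * X 0 ω +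
      ouNoise lam (fun t ↦ N (lam * t)) t ω := by
  filter_upwards [hX.eqn, (hN.comp_mul lam).ae_incrPath] with ω hω hM t
  have := eq_of_integral_equation (l := lam) (x := fun s ↦ X s.toNNReal ω) hM.1 hM.2
    (fun s hs ↦ ?_) t.2
  · simp only [NNReal.val_eq_coe, Real.toNNReal_coe, Real.toNNReal_zero] at this
    rw [this, ouNoise, mul_add]
  · have h1 := hω s.toNNReal
    simp only [Real.coe_toNNReal s hs] at h1
    refine ⟨h1.1, ?_⟩
    rw [h1.2]
    simp [incrPath]

/-- Stationarity lets time run to infinity without changing the law of `X`, whereas the initial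
value is forgotten. Hence the joint law is that of the noise on the whole line, whatever the
dependence between `X 0` and the noise. -/
lemma IsStrictlyStationary.integral_cexp_sum [IsProbabilityMeasure P] {ι : Type*} [Fintype ι]
    (hX : IsOUSolution lam N X P) (hs : IsStrictlyStationary X P)
    (hN : IsPoissonProcess θ a N P) (hlam : 0 < lam) (c : ι → ℝ) (t : ι → ℝ≥0) :
    ∫ ω, Complex.exp (Complex.I * ((∑ j, c j * X (t j) ω : ℝ) : ℂ)) ∂P =
      Complex.exp (θ * (lam * stationaryExponent a lam c fun j ↦ t j)) := by
  classical
  have hlam' : (0 : ℝ) < lam := hlam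
  set Z : ℝ≥0 → Ω → ℝ := fun t ↦ N (lam * t) with hZdef
  have hZ : IsPoissonProcess (θ * lam) a Z P := hN.comp_mul lam
  -- the law of the shifted process
  have hA (n : ℕ) : ∫ ω, Complex.exp (Complex.I * ((∑ j, c j * X (t j + n) ω : ℝ) : ℂ)) ∂P =
      ∫ ω, Complex.exp (Complex.I * ((∑ j, c j * X (t j) ω : ℝ) : ℂ)) ∂P := by
    -- the times `t j` may coincide, so the vector indexed by their image is pulled back along `t`
    let J : Finset ℝ≥0 := Finset.univ.image t
    have hJ (j : ι) : t j ∈ J := Finset.mem_image_of_mem t (Finset.mem_univ j)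
    exact ((hs n J).comp (u := fun x : J → ℝ ↦
      Complex.exp (Complex.I * ((∑ j, c j * x ⟨t j, hJ j⟩ : ℝ) : ℂ)))
      (by fun_prop)).integral_eq
  -- the law of the noise up to a late time
  have hB : Tendsto (fun n : ℕ ↦ ∫ ω, Complex.exp (Complex.I *
      ((∑ j, c j * ouNoise lam Z (t j + n) ω : ℝ) : ℂ)) ∂P) atTop
      (𝓝 (Complex.exp (θ * (lam * stationaryExponent a lam c fun j ↦ t j)))) := by
    have h1 (n : ℕ) := hZ.integral_cexp_sum_ouNoise hlam'.le (c := c)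
      (t := fun j ↦ (t j : ℝ) + n) (fun j ↦ by positivity)
    simp only [h1, NNReal.coe_mul, Complex.ofReal_mul, mul_assoc]
    exact (Complex.continuous_exp.tendsto _).comp
      (((tendsto_integral_Ioi_ouKernel hlam' a c fun j ↦ (t j : ℝ)).const_mul _).const_mul _)
  have hmX (n : ℕ) : AEMeasurable (fun ω ↦ Complex.exp (Complex.I *
      ((∑ j, c j * X (t j + n) ω : ℝ) : ℂ))) P :=
    Complex.measurable_exp.comp_aemeasurable ((Complex.measurable_ofReal.comp_aemeasurable
      (Finset.aemeasurable_fun_sum _ fun j _ ↦ (hX.aemeasurable _).const_mul _)).const_mul _)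
  have hmY (n : ℕ) : AEMeasurable (fun ω ↦ Complex.exp (Complex.I *
      ((∑ j, c j * ouNoise lam Z (t j + n) ω : ℝ) : ℂ))) P :=
    Complex.measurable_exp.comp_aemeasurable ((Complex.measurable_ofReal.comp_aemeasurable
      (Finset.aemeasurable_fun_sum _ fun j _ ↦
        (hZ.aemeasurable_ouNoise hlam'.le (by positivity)).const_mul _)).const_mul _)
  have hunit {f : Ω → ℝ} (hf : AEMeasurable (fun ω ↦ Complex.exp (Complex.I * (f ω : ℂ))) P) :
      Integrable (fun ω ↦ Complex.exp (Complex.I * (f ω : ℂ))) P :=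
    (integrable_const (1 : ℝ)).mono' hf.aestronglyMeasurable
      (ae_of_all _ fun ω ↦ (Complex.norm_exp_I_mul_ofReal _).le)
  -- the initial value is forgotten
  have hAB : Tendsto (fun n : ℕ ↦ ∫ ω, (Complex.exp (Complex.I *
      ((∑ j, c j * X (t j + n) ω : ℝ) : ℂ)) - Complex.exp (Complex.I *
      ((∑ j, c j * ouNoise lam Z (t j + n) ω : ℝ) : ℂ))) ∂P) atTop (𝓝 (∫ _, (0 : ℂ) ∂P)) := by
    refine tendsto_integral_of_dominated_convergence (fun _ ↦ 2)
      (fun n ↦ ((hmX n).sub (hmY n)).aestronglyMeasurable) (integrable_const _)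
      (fun n ↦ ae_of_all _ fun ω ↦ ?_) ?_
    · refine (norm_sub_le _ _).trans ?_
      rw [Complex.norm_exp_I_mul_ofReal, Complex.norm_exp_I_mul_ofReal]
      norm_num
    · filter_upwards [hX.ae_eq hN] with ω hω
      have hlip (x y : ℝ) : ‖Complex.exp (Complex.I * (x : ℂ)) -
          Complex.exp (Complex.I * (y : ℂ))‖ ≤ |x - y| := by
        have h1 : Complex.exp (Complex.I * (x : ℂ)) - Complex.exp (Complex.I * (y : ℂ)) =
            Complex.exp (Complex.I * (y : ℂ)) * jumpSymbol (x - y) := by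
          rw [jumpSymbol, mul_sub, ← Complex.exp_add, mul_one]
          congr 2
          push_cast; ring
        rw [h1, norm_mul, Complex.norm_exp_I_mul_ofReal, one_mul]
        exact norm_jumpSymbol_le_abs _
      refine squeeze_zero_norm (fun n ↦ hlip _ _) ?_
      have h2 (n : ℕ) : ∑ j, c j * X (t j + n) ω - ∑ j, c j * ouNoise lam Z (t j + n) ω =
          ∑ j, c j * (Real.exp (-lam * t j) * Real.exp (-lam * n) * X 0 ω) := by
        rw [← Finset.sum_sub_distrib]
        refine Finset.sum_congr rfl fun j _ ↦ ?_
        rw [hω (t j + n), ← Real.exp_add, ← mul_add, hZdef]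
        push_cast
        ring
      simp only [h2]
      have h3 : Tendsto (fun n : ℕ ↦ Real.exp (-lam * n)) atTop (𝓝 0) :=
        Real.tendsto_exp_atBot.comp
          (tendsto_natCast_atTop_atTop.const_mul_atTop_of_neg (neg_lt_zero.2 hlam'))
      have h4 := (tendsto_finsetSum (Finset.univ : Finset ι) fun j _ ↦
        ((h3.const_mul (Real.exp (-lam * t j))).mul_const (X 0 ω)).const_mul (c j)).abs
      simpa using h4
  have hsum := hAB.add hB
  simp only [integral_sub (hunit (hmX _)) (hunit (hmY _)), hA, sub_add_cancel, integral_zero,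
    zero_add] at hsum
  exact tendsto_nhds_unique tendsto_const_nhds hsum

lemma IsStrictlyStationary.charFun_map [IsProbabilityMeasure P]
    (hX : IsOUSolution lam N X P) (hs : IsStrictlyStationary X P)
    (hN : IsPoissonProcess θ a N P) (hlam : 0 < lam) (t : ℝ≥0) (u : ℝ) :
    charFun (P.map (X t)) u = dickmanCharFun θ a u := by
  have h := hs.integral_cexp_sum hX hN hlam (fun _ : Unit ↦ u) (fun _ ↦ t)
  rw [mul_stationaryExponent_unit (by exact_mod_cast hlam)] at h
  rw [charFun_apply_real, integral_map (hX.aemeasurable t) (by fun_prop), dickmanCharFun]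
  refine Eq.trans ?_ h
  refine integral_congr_ae (ae_of_all _ fun ω ↦ ?_)
  simp [mul_comm Complex.I]

/-- The innovation over `[t, t + τ]` is independent of the present value. Without a filtration for
`X` this is read off the joint characteristic function. -/
lemma IsStrictlyStationary.indepFun_innovation [IsProbabilityMeasure P]
    (hX : IsOUSolution lam N X P) (hs : IsStrictlyStationary X P)
    (hN : IsPoissonProcess θ a N P) (hlam : 0 < lam) (t τ : ℝ≥0) :
    IndepFun (X t) (fun ω ↦ X (t + τ) ω - Real.exp (-lam * τ) * X t ω) P := by
  have hlam' : (0 : ℝ) < lam := hlam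
  have hmX := hX.aemeasurable t
  have hmR : AEMeasurable (fun ω ↦ X (t + τ) ω - Real.exp (-lam * τ) * X t ω) P :=
    (hX.aemeasurable _).sub (hmX.const_mul _)
  have hcoe : (fun j ↦ ((![t, t + τ] : Fin 2 → ℝ≥0) j : ℝ)) = ![(t : ℝ), t + τ] := by
    ext j; fin_cases j <;> simp
  have key (u v : ℝ) : ∫ ω, Complex.exp (Complex.I * ((u * X t ω +
      v * (X (t + τ) ω - Real.exp (-lam * τ) * X t ω) : ℝ) : ℂ)) ∂P =
      Complex.exp (θ * (lam * stationaryExponent a lam ![u - v * Real.exp (-lam * τ), v]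
        ![(t : ℝ), t + τ])) := by
    have h := hs.integral_cexp_sum hX hN hlam ![u - v * Real.exp (-lam * τ), v] ![t, t + τ]
    rw [hcoe] at h
    rw [← h]
    refine integral_congr_ae (ae_of_all _ fun ω ↦ ?_)
    simp only [Fin.sum_univ_two, Matrix.cons_val_zero, Matrix.cons_val_one]
    ring_nf
  rw [indepFun_iff_charFun_prod hmX hmR]
  intro p
  have hX1 : charFun (P.map (X t)) p.ofLp.1 = Complex.exp (θ * (lam *
      stationaryExponent a lam ![p.ofLp.1, 0] ![(t : ℝ), t + τ])) := by
    have := key p.ofLp.1 0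
    simp only [zero_mul, add_zero, sub_zero] at this
    rw [charFun_apply_real, integral_map hmX (by fun_prop), ← this]
    refine integral_congr_ae (ae_of_all _ fun ω ↦ ?_)
    simp [mul_comm Complex.I]
  have hR1 : charFun (P.map fun ω ↦ X (t + τ) ω - Real.exp (-lam * τ) * X t ω) p.ofLp.2 =
      Complex.exp (θ * (lam * stationaryExponent a lam
        ![-p.ofLp.2 * Real.exp (-lam * τ), p.ofLp.2] ![(t : ℝ), t + τ])) := by
    have := key 0 p.ofLp.2
    simp only [zero_mul, zero_add, zero_sub, ← neg_mul p.ofLp.2] at this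
    rw [charFun_apply_real, integral_map hmR (by fun_prop), ← this]
    refine integral_congr_ae (ae_of_all _ fun ω ↦ ?_)
    simp [mul_comm Complex.I]
  have hmXR : AEMeasurable (fun ω ↦ WithLp.toLp 2
      (X t ω, X (t + τ) ω - Real.exp (-lam * τ) * X t ω)) P := by fun_prop
  rw [hX1, hR1, ← Complex.exp_add, ← mul_add, ← mul_add,
    ← stationaryExponent_innovation hlam' a _ _ τ.coe_nonneg, charFun_apply,
    integral_map hmXR (by fun_prop)]
  refine Eq.trans ?_ (key p.ofLp.1 p.ofLp.2)
  refine integral_congr_ae (ae_of_all _ fun ω ↦ ?_)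
  simp only [WithLp.prod_inner_apply, Real.inner_apply]
  rw [mul_comm Complex.I]
  ring_nf

/-- There is a Dickman law, found as the limit law of the stochastic convolution. -/
lemma IsPoissonProcess.exists_charFun_eq [IsProbabilityMeasure P]
    (hN : IsPoissonProcess θ a N P) :
    ∃ μ : Measure ℝ, IsProbabilityMeasure μ ∧ ∀ u, charFun μ u = dickmanCharFun θ a u := by
  have hm (n : ℕ) := hN.aemeasurable_ouNoise (l := 1) zero_le_one (Nat.cast_nonneg n)
  have hprob (n : ℕ) : IsProbabilityMeasure (P.map (ouNoise 1 N n)) :=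
    Measure.isProbabilityMeasure_map (hm n)
  refine exists_charFun_eq_of_tendsto (μ := fun n : ℕ ↦ P.map (ouNoise 1 N n))
    (continuousAt_dickmanCharFun_zero θ a) fun u ↦ ?_
  have h1 (n : ℕ) : charFun (P.map (ouNoise 1 N n)) u = Complex.exp (θ *
      ∫ s in Ioi 0, jumpSymbol (a * ouKernel 1 (fun _ : Unit ↦ u) (fun _ ↦ 0 + (n : ℝ)) s)) := by
    rw [← hN.integral_cexp_sum_ouNoise zero_le_one (fun _ ↦ by positivity), charFun_apply_real,
      integral_map (hm n) (by fun_prop)]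
    refine integral_congr_ae (ae_of_all _ fun ω ↦ ?_)
    simp [mul_comm Complex.I]
  simp only [h1]
  have h2 := mul_stationaryExponent_unit one_pos a u 0
  rw [Complex.ofReal_one, one_mul] at h2
  rw [dickmanCharFun, ← h2]
  exact (Complex.continuous_exp.tendsto _).comp
    ((tendsto_integral_Ioi_ouKernel one_pos a (fun _ : Unit ↦ u) fun _ ↦ 0).const_mul _)

/-- The solution whose initial value is the second coordinate of the enlarged space. -/
noncomputable def ouProcess (lam : ℝ≥0) (N : ℝ≥0 → Ω → ℝ) (t : ℝ≥0) (p : Ω × ℝ) : ℝ :=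
  Real.exp (-lam * t) * p.2 + ouNoise lam (fun t ↦ N (lam * t)) t p.1

lemma aemeasurable_ouProcess (hN : IsPoissonProcess θ a N P) (μ : Measure ℝ)
    [SFinite P] [SFinite μ] (t : ℝ≥0) : AEMeasurable (ouProcess lam N t) (P.prod μ) :=
  (measurable_snd.const_mul _).aemeasurable.add
    ((hN.comp_mul lam).aemeasurable_ouNoise lam.2 t.2).comp_fst

lemma isOUSolution_ouProcess (hN : IsPoissonProcess θ a N P) (hlam : 0 < lam) (μ : Measure ℝ)
    [SFinite P] [SFinite μ] :
    IsOUSolution lam (fun t p ↦ N t p.1) (ouProcess lam N) (P.prod μ) where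
  aemeasurable := aemeasurable_ouProcess hN μ
  eqn := by
    have hlam' : (lam : ℝ) ≠ 0 := by exact_mod_cast hlam.ne'
    filter_upwards [Measure.quasiMeasurePreserving_fst.ae (hN.comp_mul lam).ae_incrPath]
      with p hp t
    have h := integral_equation_of_eq hlam' hp.1 hp.2 p.2 t.coe_nonneg
    have heq (s : ℝ≥0) : ouProcess lam N s p = Real.exp (-lam * s) *
        (p.2 + expIntegral lam (incrPath (fun t ↦ N (lam * t)) p.1) s) := by
      rw [ouProcess, ouNoise, mul_add]
    have hcongr : EqOn (fun s : ℝ ↦ Real.exp (-lam * s) *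
        (p.2 + expIntegral lam (incrPath (fun t ↦ N (lam * t)) p.1) s))
        (fun s : ℝ ↦ ouProcess lam N s.toNNReal p) (uIoc 0 t) := by
      intro s hs
      rw [uIoc_of_le t.coe_nonneg] at hs
      simp only [heq, Real.coe_toNNReal s hs.1.le]
    refine ⟨h.1.congr hcongr, ?_⟩
    rw [← intervalIntegral.integral_congr_ae (ae_of_all _ hcongr), heq t, heq 0]
    refine h.2.trans ?_
    simp [expIntegral, incrPath]

/-- With a Dickman initial value independent of the noise, the joint characteristic functions are
those of the noise on the whole line. -/
lemma integral_cexp_sum_ouProcess [IsProbabilityMeasure P] {ι : Type*} [Fintype ι]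
    (hN : IsPoissonProcess θ a N P) (hlam : 0 < lam) {μ : Measure ℝ} [IsProbabilityMeasure μ]
    (hμ : ∀ u, charFun μ u = dickmanCharFun θ a u) (c : ι → ℝ) (t : ι → ℝ≥0) :
    ∫ p, Complex.exp (Complex.I * ((∑ j, c j * ouProcess lam N (t j) p : ℝ) : ℂ)) ∂(P.prod μ) =
      Complex.exp (θ * (lam * stationaryExponent a lam c fun j ↦ t j)) := by
  have hlam' : (0 : ℝ) < lam := hlam
  have hsplit (p : Ω × ℝ) :
      Complex.exp (Complex.I * ((∑ j, c j * ouProcess lam N (t j) p : ℝ) : ℂ)) =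
      Complex.exp (Complex.I *
        ((∑ j, c j * ouNoise lam (fun t ↦ N (lam * t)) (t j) p.1 : ℝ) : ℂ)) *
      Complex.exp ((∑ j, c j * Real.exp (-lam * t j) : ℝ) * p.2 * Complex.I) := by
    rw [← Complex.exp_add, mul_comm _ Complex.I, ← mul_add, ← Complex.ofReal_mul,
      ← Complex.ofReal_add, Finset.sum_mul, ← Finset.sum_add_distrib]
    congr 3
    refine Finset.sum_congr rfl fun j _ ↦ ?_
    rw [ouProcess]; ring
  simp only [hsplit]
  rw [integral_prod_mul (fun ω ↦ Complex.exp (Complex.I *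
      ((∑ j, c j * ouNoise lam (fun t ↦ N (lam * t)) (t j) ω : ℝ) : ℂ)))
      (fun x : ℝ ↦ Complex.exp ((∑ j, c j * Real.exp (-lam * t j) : ℝ) * x * Complex.I)),
    ← charFun_apply_real, hμ,
    (hN.comp_mul lam).integral_cexp_sum_ouNoise (t := fun j ↦ (t j : ℝ))
      hlam'.le (fun j ↦ (t j).coe_nonneg), dickmanCharFun,
    ← Complex.exp_add]
  have := mul_stationaryExponent (c := c) hlam' a (t := fun j ↦ (t j : ℝ)) (fun j ↦ (t j).coe_nonneg)
  rw [this]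
  congr 1
  push_cast
  ring

/-- The finite-dimensional characteristic functions depend on the times only through the shift
invariant `stationaryExponent`. -/
lemma isStrictlyStationary_ouProcess [IsProbabilityMeasure P]
    (hN : IsPoissonProcess θ a N P) (hlam : 0 < lam) {μ : Measure ℝ} [IsProbabilityMeasure μ]
    (hμ : ∀ u, charFun μ u = dickmanCharFun θ a u) :
    IsStrictlyStationary (ouProcess lam N) (P.prod μ) := by
  intro h J
  have hm (g : J → ℝ≥0) : AEMeasurable (fun p (i : J) ↦ ouProcess lam N (g i) p) (P.prod μ) :=
    aemeasurable_pi_lambda _ fun i ↦ aemeasurable_ouProcess hN μ _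
  have hch (g : J → ℝ≥0) (L : StrongDual ℝ (J → ℝ)) :
      charFunDual ((P.prod μ).map fun p (i : J) ↦ ouProcess lam N (g i) p) L =
        Complex.exp (θ * (lam * stationaryExponent a lam (fun i ↦ L (Pi.single i 1))
          fun i ↦ g i)) := by
    rw [charFunDual_apply, integral_map (hm g) (by fun_prop),
      ← integral_cexp_sum_ouProcess hN hlam hμ]
    refine integral_congr_ae (ae_of_all _ fun p ↦ ?_)
    simp only
    have hL := LinearMap.pi_apply_eq_sum_univ (L : (J → ℝ) →ₗ[ℝ] ℝ)
      (fun i ↦ ouProcess lam N (g i) p)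
    simp only [ContinuousLinearMap.coe_coe, smul_eq_mul] at hL
    rw [hL, mul_comm Complex.I]
    congr 4
    ext i
    rw [mul_comm]
    congr 2
    ext k
    simp [Pi.single_apply, eq_comm]
  refine ⟨hm fun i ↦ i + h, hm fun i ↦ i, Measure.ext_of_charFunDual (funext fun L ↦ ?_)⟩
  rw [hch (fun i ↦ i + h) L, hch (fun i ↦ i) L]
  simp only [NNReal.coe_add, stationaryExponent_add]

end Solutions

theorem theorem3p1 {Ω : Type*} [MeasurableSpace Ω] (P : Measure Ω) [IsProbabilityMeasure P]
    (θ lam : ℝ≥0) (a : ℝ) (hθ : 0 < θ) (hlam : 0 < lam) (ha : 0 < a)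
    (N : ℝ≥0 → Ω → ℝ) (hN : IsPoissonProcess θ a N P) :
    -- a stationary solution exists, with initial value independent of the driving process
    (∃ μ : Measure ℝ, IsGenDickman θ a μ ∧
      ∃ X : ℝ≥0 → Ω × ℝ → ℝ, X 0 = Prod.snd ∧
        IsOUSolution lam (fun t ω ↦ N t ω.1) X (P.prod μ) ∧
        IsStrictlyStationary X (P.prod μ)) ∧
    -- every stationary solution has the stated marginals and covariances
    (∀ X : ℝ≥0 → Ω → ℝ, IsOUSolution lam N X P → IsStrictlyStationary X P →
      ∀ t : ℝ≥0, IsGenDickman θ a (P.map (X t)) ∧ MemLp (X t) 2 P ∧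
        ∀ τ : ℝ≥0,
          covariance (X t) (X (t + τ)) P = Real.exp (-(lam * τ)) * variance (X t) P ∧
          covariance (X t) (X (t + τ)) P = a ^ 2 * (θ / 2) * Real.exp (-(lam * τ))) := by
  constructor
  · obtain ⟨μ, hprob, hμ⟩ := hN.exists_charFun_eq
    refine ⟨μ, isGenDickman_of_charFun hθ hμ, ouProcess lam N, ?_,
      isOUSolution_ouProcess hN hlam μ, isStrictlyStationary_ouProcess hN hlam hμ⟩
    ext p
    simp [ouProcess, ouNoise_zero]
  · intro X hX hs t
    have hprob (s : ℝ≥0) : IsProbabilityMeasure (P.map (X s)) :=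
      Measure.isProbabilityMeasure_map (hX.aemeasurable s)
    have hφ (s : ℝ≥0) := hs.charFun_map hX hN hlam s
    have hGD := isGenDickman_of_charFun hθ (hφ t)
    have hL2 (s : ℝ≥0) : MemLp (X s) 2 P := by
      have := memLp_two_of_charFun θ.2 (hφ s)
      rwa [memLp_map_measure_iff (by fun_prop) (hX.aemeasurable s)] at this
    have hvar : variance (X t) P = a ^ 2 * (θ / 2) := by
      rw [← hGD.variance_eq hθ (memLp_two_of_charFun θ.2 (hφ t)),
        variance_id_map (hX.aemeasurable t)]
    refine ⟨hGD, hL2 t, fun τ ↦ ?_⟩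
    set R : Ω → ℝ := fun ω ↦ X (t + τ) ω - Real.exp (-lam * τ) * X t ω with hR
    have hRL2 : MemLp R 2 P := (hL2 (t + τ)).sub ((hL2 t).const_mul _)
    have hdecomp : X (t + τ) = (fun ω ↦ Real.exp (-lam * τ) * X t ω) + R := by
      ext ω; simp [hR]
    have hcov : covariance (X t) (X (t + τ)) P =
        Real.exp (-(lam * τ)) * variance (X t) P := by
      rw [hdecomp, covariance_add_right (hL2 t) ((hL2 t).const_mul _) hRL2,
        covariance_const_mul_right, covariance_self (hX.aemeasurable t),
        (hs.indepFun_innovation hX hN hlam t τ).covariance_eq_zero (hL2 t) hRL2, add_zero, neg_mul]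
    exact ⟨hcov, by rw [hcov, hvar, mul_comm]⟩
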